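/- Let $0<\delta\le\pi/2$, let $S_\delta=\{w\in\mathbb C\setminus\{0\}: |\arg w|<\delta\}$, let $D\subseteq\mathbb C$ be open, and let $\alpha\in\mathbb C\setminus\mathbb Z_{\le 0}$. All powers and arguments are principal ($(-1)^\alpha=e^{i\pi\alpha}$). Let $y_0,y_1,y_2,\dots$ and $\chi$ be holomorphic on $D$ with $\chi(D)\subseteq S_\delta$, and let $a:D\to\mathbb C\setminus\{0\}$. The *Stokes line* is $l_\chi=\{z\in D:\operatorname{Im}\chi(z)=0,\ \operatorname{Re}\chi(z)>0\}$. Suppose the following. 1. (Late terms.) For every $z\in D$, $$y_{n+1}(z)\sim\frac{n^{\alpha-1}\,n!\,(-1)^{\alpha}a(z)}{\chi(z)^{n+\alpha}\,\Gamma(\alpha)}\qquad(n\to\infty).$$ 2. (Borel transform.) $y_B(w,z)$ is the analytic continuation of the germ $\sum_{n\ge0}\frac{y_{n+1}(z)}{n!}w^n$ at $w=0$ to $\bigl(\{|w|<|\chi(z)|\}\cup S_\delta\bigr)\setminus\{t\chi(z):t\ge1\}$, and is holomorphic in $(w,z)$ for $w$ in this region and $z\in D$. 3. (Associated power-law singularity.)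 For every $z\in D$ there are functions $h,g$ of $w$ (depending on $z$), holomorphic near $\chi(z)$, with $h(\chi(z))\ne0$ and $y_B(w,z)=\bigl(1-\tfrac{w}{\chi(z)}\bigr)^{-\alpha}h(w)+g(w)$ for $w$ near $\chi(z)$ off the cut $\{t\chi(z):t\ge1\}$. (That is, up to a constant branch factor absorbed in $h$, $y_B=(w-\chi)^{-\alpha}(a_0+a_1(w-\chi)+\dots)+\text{reg.}$; the amplitude is not prescribed.) 4. (Borel summability off the singular direction.) For every $z_1\in D$ and every $\theta_1\in(-\delta,\delta)$ with $\theta_1\neq\arg\chi(z_1)$ there are $C,B$ with $|y_B(te^{i\theta},z)|\le Ce^{Bt}$ for all $t>0$ and all $(\theta,z)$ near $(\theta_1,z_1)$. For $\varepsilon>0$ let $Y_\theta(z;\varepsilon)=y_0(z)+\int_{e^{i\theta}(0,\infty)}e^{-w/\varepsilon}\,y_B(w,z)\,dw$ be the Borel sum along the ray of direction $\theta$; $Y_0$ is the Borel sum along $(0,\infty)$. Fix $\theta\in(0,\delta)$ and put $V=\{z\in D:|\arg\chi(z)|<\theta\}$, an open set containing $l_\chi$. Then: * for every $z_1\in V$,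 for all sufficiently small $\varepsilon>0$ and all $z$ sufficiently near $z_1$, the integrals defining $Y_{\pm\theta}(z;\varepsilon)$ converge absolutely and $Y_{\pm\theta}(\cdot\,;\varepsilon)$ are complex differentiable at $z$; * for every $z_1\in V$ with $\operatorname{Im}\chi(z_1)<0$ (respectively $\operatorname{Im}\chi(z_1)>0$), for all sufficiently small $\varepsilon>0$ and all $z$ sufficiently near $z_1$, the integral defining $Y_0(z;\varepsilon)$ converges absolutely and $Y_0(z;\varepsilon)=Y_{\theta}(z;\varepsilon)$ (respectively $Y_0(z;\varepsilon)=Y_{-\theta}(z;\varepsilon)$), so that $Y_{\theta}$ and $Y_{-\theta}$ continue the Borel sums from the two sides across the Stokes line; * for every $z\in V$, in particular for every $z\in l_\chi$, these two Borel sums differ to leading order by $$Y_{\theta}(z;\varepsilon)-Y_{-\theta}(z;\varepsilon)\ \sim\ \left[\frac{2\pi i\,(-1)^{\alpha}a(z)}{\varepsilon^{\alpha-1}\,\Gamma(\alpha)}\right]e^{-\chi(z)/\varepsilon}\qquad(\varepsilon\to0^+).$$ -/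

import Mathlib

open Filter Topology Set MeasureTheory Asymptotics

noncomputable section

/-- The part of the ray from `0` through `χ` that starts at `χ`: the cut that carries the
singularity `χ` of the Borel transform (and possibly others further out). -/
def singularCut (χ : ℂ) : Set ℂ := {w | ∃ t : ℝ, 1 ≤ t ∧ w = (t : ℂ) * χ}

/-- The open sector of half-opening `δ` around the positive real axis. -/
def openSector (δ : ℝ) : Set ℂ := {w | w ≠ 0 ∧ |Complex.arg w| < δ}

/-- Region of the Borel plane: the disc around `0` that reaches to `χ`, and a sector around the
integration contour `(0, ∞)`, both cut outward from `χ`. Nothing is asked outside it. -/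
def borelDomain (δ : ℝ) (χ : ℂ) : Set ℂ :=
  (Metric.ball 0 ‖χ‖ ∪ openSector δ) \ singularCut χ

/-- `yB w z` is, for `z ∈ D`, the analytic continuation to the region `borelDomain δ (χ z)` of the
germ `∑ y_{n+1}(z) wⁿ / n!`, and depends holomorphically on `(w, z)`. -/
structure IsParametricBorelTransform (D : Set ℂ) (δ : ℝ) (χ : ℂ → ℂ) (y : ℕ → ℂ → ℂ)
    (yB : ℂ → ℂ → ℂ) : Prop where
  holomorphic : DifferentiableOn ℂ (fun p : ℂ × ℂ => yB p.1 p.2)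
    {p : ℂ × ℂ | p.2 ∈ D ∧ p.1 ∈ borelDomain δ (χ p.2)}
  germ : ∀ z ∈ D, ∀ᶠ w in 𝓝 (0 : ℂ),
    HasSum (fun n : ℕ => y (n + 1) z / (n.factorial : ℂ) * w ^ n) (yB w z)

/-- `f` has a power law singularity with power `-α` at `χ ≠ 0`:
`f(w) = (w - χ)^{-α} (a₀ + a₁ (w - χ) + …) + reg.` near `χ`, with `a₀ ≠ 0`. The branch of
`(w - χ)^{-α}` is `(1 - w/χ)^{-α}` (principal, so cut exactly along `singularCut χ`) times a
constant `(-χ)^{-α}`; that constant is absorbed in the unspecified amplitude `h`. -/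
def HasPowerLawSingularity (f : ℂ → ℂ) (χ α : ℂ) : Prop :=
  ∃ h g : ℂ → ℂ, AnalyticAt ℂ h χ ∧ AnalyticAt ℂ g χ ∧ h χ ≠ 0 ∧
    ∀ᶠ w in 𝓝 χ, w ∉ singularCut χ → f w = (1 - w / χ) ^ (-α) * h w + g w

/-- The ray of direction `θ`, parametrized by arc length. -/
def rayPoint (θ t : ℝ) : ℂ := (t : ℂ) * Complex.exp (θ * Complex.I)

/-- Borel summability in the direction `θ` at the parameter `z₁`: at most exponential growth,
locally uniform in the direction and in the parameter. -/
def BorelSummableAt (yB : ℂ → ℂ → ℂ) (θ : ℝ) (z₁ : ℂ) : Prop :=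
  ∃ C B : ℝ, ∀ᶠ p : ℝ × ℂ in 𝓝 (θ, z₁), ∀ t : ℝ, 0 < t →
    ‖yB (rayPoint p.1 t) p.2‖ ≤ C * Real.exp (B * t)

/-- The integrand of `∫ e^{-w/ε} yB(w,z) dw` along the ray `w = t e^{iθ}`, `t > 0`. -/
def borelIntegrand (yB : ℂ → ℂ → ℂ) (θ ε : ℝ) (z : ℂ) (t : ℝ) : ℂ :=
  Complex.exp (-(rayPoint θ t) / (ε : ℂ)) * yB (rayPoint θ t) z * Complex.exp (θ * Complex.I)

/-- The Borel sum `y₀(z) + ∫ e^{-w/ε} yB(w,z) dw` along the ray of direction `θ`. -/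
def borelSum (y : ℕ → ℂ → ℂ) (yB : ℂ → ℂ → ℂ) (θ ε : ℝ) (z : ℂ) : ℂ :=
  y 0 z + ∫ t in Ioi (0 : ℝ), borelIntegrand yB θ ε z t

/-- The Borel sum along the ray of direction `θ` exists as an absolutely convergent integral. -/
def BorelSumExists (yB : ℂ → ℂ → ℂ) (θ ε : ℝ) (z : ℂ) : Prop :=
  IntegrableOn (borelIntegrand yB θ ε z) (Ioi (0 : ℝ))

/-- The Stokes line in `D`: the points where the singularity lies on the contour `(0, ∞)`. -/
def stokesLine (D : Set ℂ) (χ : ℂ → ℂ) : Set ℂ := {z ∈ D | (χ z).im = 0 ∧ 0 < (χ z).re}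

end

/-!
Everything happens in the Borel plane of a fixed `z`; write `f = yB · z` and `χ = χ z`, and let
`laplaceRay f θ ε` be the Laplace integral of `f` along the ray of direction `θ`.

*The jump for `Re α > 1`.* By Cauchy's theorem (`integral_ray_eq_of_primitive`, applied to a
primitive of the integrand on the star-shaped domain of `f`) the rays of direction `±θ` from `0` may
be replaced by the rays of the same directions from the vertex `(1 - ε) χ`; the two pieces from `0`
to the vertex cancel in the difference (`eventually_laplaceRay_eq`). After rescaling by `ε` around
`χ` the exponential growth of `f` is negligible, `(1 - w / χ) ^ (-α)` produces exactly the power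
`ε ^ (-α)`, and dominated convergence leaves `h χ` times a Hankel integral
(`HasSingularExpansion.tendsto_vertexRay`). For `Re α > 1` the two arms of the Hankel contour can be
turned up to the vertical, where Hankel's formula is Fourier inversion for `t ^ (α - 1) e ^ (-χ t)`
(`hankelRay_sub_hankelRay`).

*The amplitude.* The singularity hypothesis leaves the amplitude `h χ` open. The late terms
determine it: they are the Taylor coefficients of `f`, and an Abelian theorem along the radius to
`χ` gives `h χ = (-1) ^ α a / χ ^ α` (`tendsto_cpow_mul_of_tendsto_coeff`,
`HasSingularExpansion.amplitude_eq`). Nothing is needed about other singularities of `f` on its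
circle of convergence.

*Arbitrary order.* Differentiation in `w` replaces `α` by `α + 1`, preserves growth, singular
expansion and late-term asymptotics (`SectorialGrowth.deriv`, `HasSingularExpansion.deriv`,
`HasLateCoefficients.deriv`), and an integration by parts divides the jump by `ε`
(`eventually_laplaceRay_deriv`). So an induction on the number of derivatives needed to reach
`Re α > 1` proves the general case (`tendsto_jump_of_lateCoefficients`). Here
`α ∉ ℤ_{≤ 0}` is essential: the induction divides by `α`.

*Existence and the two sides.* The growth hypothesis dominates the Borel integrals uniformly near
`z₁`, whence convergence and holomorphy (`eventually_borelSum_differentiableAt`); when `χ z₁` is off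
the closed sector between the rays of directions `0` and `±θ`, Cauchy's theorem identifies their
Borel sums (`eventually_borelSum_eq`).
-/

/-! ### Primitives on star-shaped domains and integrals along rays -/

/-- A holomorphic function on an open set that is star-shaped about `0` has a primitive. -/
theorem exists_primitive_of_starConvex {U : Set ℂ} (hU : IsOpen U) (hs : StarConvex ℝ 0 U)
    {f : ℂ → ℂ} (hf : DifferentiableOn ℂ f U) :
    ∃ P : ℂ → ℂ, ∀ w ∈ U, HasDerivAt P (f w) w := by
  let ω : ℂ → ℂ →L[ℂ] ℂ := fun w => ContinuousLinearMap.smulRightL ℂ ℂ ℂ 1 (f w)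
  refine ⟨fun b => curveIntegral ω (.segment 0 b), fun b hb => ?_⟩
  obtain ⟨r, hr, hball⟩ := Metric.isOpen_iff.1 hU b hb
  -- near `b` the problem lives on the cone over a ball, which is convex
  set S : Set ℂ := convexJoin ℝ {0} (Metric.ball b r) with hS
  have hconv : Convex ℝ S := (convex_singleton _).convexJoin (convex_ball _ _)
  have hSU : S ⊆ U := by
    intro w hw
    obtain ⟨a, ha, c, hc, hw⟩ := mem_convexJoin.1 hw
    rw [mem_singleton_iff] at ha
    subst ha
    exact hs.segment_subset (hball hc) hw
  have hballS : Metric.ball b r ⊆ S := by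
    intro w hw
    exact mem_convexJoin.2 ⟨0, rfl, w, hw, right_mem_segment ℝ 0 w⟩
  have hbS : b ∈ S := hballS (Metric.mem_ball_self hr)
  have h0S : (0 : ℂ) ∈ S :=
    mem_convexJoin.2 ⟨0, rfl, b, Metric.mem_ball_self hr, left_mem_segment ℝ 0 b⟩
  have key := hconv.hasFDerivWithinAt_curveIntegral_segment_of_hasFDerivWithinAt_symmetric
    (ω := ω) (dω := fun w => ((ContinuousLinearMap.smulRightL ℂ ℂ ℂ 1).restrictScalars ℝ) ∘L
      ((ContinuousLinearMap.toSpanSingleton ℂ (deriv f w)).restrictScalars ℝ))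
    (a := 0) (b := b) ?_ ?_ h0S hbS
  · have h2 := key.hasFDerivAt (Filter.mem_of_superset (Metric.ball_mem_nhds b hr) hballS)
    rw [hasDerivAt_iff_hasFDerivAt]
    exact h2
  · intro w hw
    have h1 : HasDerivAt f (deriv f w) w :=
      (hf.differentiableAt (hU.mem_nhds (hSU hw))).hasDerivAt
    have h2 := ((ContinuousLinearMap.smulRightL ℂ ℂ ℂ 1).hasFDerivAt.comp w
      h1.hasFDerivAt).restrictScalars ℝ
    exact h2.hasFDerivWithinAt
  · intro a _ x _ y _
    simp
    ring

/-- The integral of `G` along a ray computes the limit of a primitive of `G`. -/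
theorem tendsto_primitive_along_ray {P G : ℂ → ℂ} {v d : ℂ}
    (hP : ∀ s : ℝ, 0 ≤ s → HasDerivAt P (G (v + s * d)) (v + s * d))
    (hI : IntegrableOn (fun s : ℝ => G (v + s * d) * d) (Ioi 0)) :
    Tendsto (fun s : ℝ => P (v + s * d)) atTop
      (𝓝 (P v + ∫ s in Ioi (0 : ℝ), G (v + s * d) * d)) := by
  have hder : ∀ s : ℝ, 0 ≤ s →
      HasDerivAt (fun s : ℝ => P (v + s * d)) (G (v + s * d) * d) s := by
    intro s hs
    have h1 : HasDerivAt (fun s : ℝ => v + (s : ℂ) * d) d s := by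
      simpa using ((Complex.ofRealCLM.hasDerivAt (x := s)).mul_const d).const_add v
    exact (hP s hs).comp s h1
  have h := (intervalIntegral_tendsto_integral_Ioi 0 hI tendsto_id).const_add (P v)
  refine h.congr' ?_
  filter_upwards [eventually_ge_atTop 0] with s hs
  have := intervalIntegral.integral_eq_sub_of_hasDerivAt (a := 0) (b := s)
    (f := fun s : ℝ => P (v + s * d)) (f' := fun s : ℝ => G (v + s * d) * d) ?_ ?_
  · simp only [id]
    rw [this]; simp
  · intro x hx
    rw [uIcc_of_le hs] at hx
    exact hder x hx.1
  · rw [intervalIntegrable_iff_integrableOn_Ioc_of_le hs]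
    exact hI.mono_set Ioc_subset_Ioi_self

/-- Cauchy's theorem for two rays: if `G` has a primitive and is small on the segments that join
the points of parameter `s` on the two rays, then the integrals along the rays differ by the
increment of the primitive between the two vertices. -/
theorem integral_ray_eq_of_primitive {P G : ℂ → ℂ} {v₁ d₁ v₂ d₂ : ℂ}
    (hP₁ : ∀ s : ℝ, 0 ≤ s → HasDerivAt P (G (v₁ + s * d₁)) (v₁ + s * d₁))
    (hP₂ : ∀ s : ℝ, 0 ≤ s → HasDerivAt P (G (v₂ + s * d₂)) (v₂ + s * d₂))
    (hI₁ : IntegrableOn (fun s : ℝ => G (v₁ + s * d₁) * d₁) (Ioi 0))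
    (hI₂ : IntegrableOn (fun s : ℝ => G (v₂ + s * d₂) * d₂) (Ioi 0))
    {b : ℝ → ℝ} (hb : Tendsto (fun s => b s * (1 + s)) atTop (𝓝 0))
    (hseg : ∀ᶠ s : ℝ in atTop, ∀ w ∈ segment ℝ (v₁ + s * d₁) (v₂ + s * d₂),
      HasDerivAt P (G w) w ∧ ‖G w‖ ≤ b s) :
    P v₁ + ∫ s in Ioi (0 : ℝ), G (v₁ + s * d₁) * d₁ =
      P v₂ + ∫ s in Ioi (0 : ℝ), G (v₂ + s * d₂) * d₂ := by
  have h1 := tendsto_primitive_along_ray hP₁ hI₁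
  have h2 := tendsto_primitive_along_ray hP₂ hI₂
  have h0 : Tendsto (fun s : ℝ => P (v₁ + s * d₁) - P (v₂ + s * d₂)) atTop (𝓝 0) := by
    have hb' := hb.mul_const (‖v₁ - v₂‖ + ‖d₁ - d₂‖)
    rw [zero_mul] at hb'
    refine squeeze_zero_norm' ?_ hb'
    filter_upwards [hseg, eventually_ge_atTop 0] with s hs hs0
    have hbs : 0 ≤ b s := (norm_nonneg _).trans (hs _ (left_mem_segment ℝ _ _)).2
    have hconv := convex_segment (𝕜 := ℝ) (v₁ + s * d₁) (v₂ + s * d₂)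
    have h3 := hconv.norm_image_sub_le_of_norm_hasDerivWithin_le
      (f := P) (f' := G) (C := b s) (fun w hw => (hs w hw).1.hasDerivWithinAt)
      (fun w hw => (hs w hw).2) (right_mem_segment ℝ _ _) (left_mem_segment ℝ _ _)
    refine h3.trans ?_
    rw [mul_assoc]
    refine mul_le_mul_of_nonneg_left ?_ hbs
    have h4 : v₁ + s * d₁ - (v₂ + s * d₂) = (v₁ - v₂) + s * (d₁ - d₂) := by ring
    rw [h4]
    refine (norm_add_le _ _).trans ?_
    rw [norm_mul, Complex.norm_real, Real.norm_of_nonneg hs0]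
    nlinarith [norm_nonneg (v₁ - v₂), norm_nonneg (d₁ - d₂)]
  have h3 := h1.sub h2
  exact sub_eq_zero.1 (tendsto_nhds_unique h3 h0)

/-- An integral that depends holomorphically on a parameter, with an integrable bound that is
uniform in the parameter, is holomorphic: Cauchy's estimate bounds the derivative. -/
theorem differentiableAt_integral_of_norm_le {X : Type*} [MeasurableSpace X] {μ : Measure X}
    {F : ℂ → X → ℂ} {z₀ : ℂ} {r : ℝ} (hr : 0 < r) {bound : X → ℝ} (hbound : Integrable bound μ)
    (hmeas : ∀ z ∈ Metric.ball z₀ r, AEStronglyMeasurable (F z) μ)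
    (hdiff : ∀ᵐ x ∂μ, DifferentiableOn ℂ (F · x) (Metric.ball z₀ r))
    (hle : ∀ᵐ x ∂μ, ∀ z ∈ Metric.ball z₀ r, ‖F z x‖ ≤ bound x) :
    DifferentiableAt ℂ (fun z => ∫ x, F z x ∂μ) z₀ := by
  have hr2 : 0 < r / 2 := half_pos hr
  have hsub : ∀ z ∈ Metric.ball z₀ (r / 2), Metric.closedBall z (r / 4) ⊆ Metric.ball z₀ r := by
    intro z hz w hw
    rw [Metric.mem_ball] at hz ⊢
    rw [Metric.mem_closedBall] at hw
    linarith [dist_triangle w z z₀]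
  have hmem0 : z₀ ∈ Metric.ball z₀ r := Metric.mem_ball_self hr
  have key := hasDerivAt_integral_of_dominated_loc_of_deriv_le (μ := μ) (𝕜 := ℂ) (F := F) (x₀ := z₀)
    (F' := fun z x => deriv (F · x) z) (s := Metric.ball z₀ (r / 2))
    (bound := fun x => bound x / (r / 4)) (Metric.ball_mem_nhds _ hr2)
    (Filter.eventually_of_mem (Metric.ball_mem_nhds _ hr) hmeas) ?_ ?_ ?_ (hbound.div_const _) ?_
  · exact key.2.differentiableAt
  · exact hbound.mono' (hmeas _ hmem0) (hle.mono fun x hx => hx _ hmem0)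
  · -- the derivative is a limit of difference quotients, hence measurable
    obtain ⟨u, hu⟩ : ∃ u : ℕ → ℂ, u = fun n : ℕ => ((r / 2 / ((n : ℝ) + 1) : ℝ) : ℂ) := ⟨_, rfl⟩
    have hu0 : Tendsto u atTop (𝓝 0) := by
      have := tendsto_one_div_add_atTop_nhds_zero_nat (𝕜 := ℝ) |>.const_mul (r / 2)
      rw [mul_zero] at this
      have h2 := (Complex.continuous_ofReal.tendsto 0).comp this
      rw [hu]
      simpa [Function.comp_def, div_eq_mul_inv] using h2
    have hune : ∀ n, u n ≠ 0 := by
      intro n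
      rw [hu]
      exact Complex.ofReal_ne_zero.2 (by positivity)
    have hun : ∀ n, z₀ + u n ∈ Metric.ball z₀ r := by
      intro n
      rw [Metric.mem_ball, dist_eq_norm, add_sub_cancel_left, hu, Complex.norm_real,
        Real.norm_of_nonneg (by positivity)]
      calc r / 2 / (n + 1) ≤ r / 2 := div_le_self hr2.le (by linarith [Nat.cast_nonneg (α := ℝ) n])
        _ < r := half_lt_self hr
    refine aestronglyMeasurable_of_tendsto_ae (u := atTop)
      (f := fun n x => (u n)⁻¹ * (F (z₀ + u n) x - F z₀ x)) ?_ ?_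
    · exact fun n => ((hmeas _ (hun n)).sub (hmeas _ hmem0)).const_mul _
    · filter_upwards [hdiff] with x hx
      have hd : HasDerivAt (F · x) (deriv (F · x) z₀) z₀ :=
        (hx.differentiableAt (Metric.ball_mem_nhds _ hr)).hasDerivAt
      have h2 := hd.tendsto_slope_zero.comp
        (tendsto_nhdsWithin_iff.2 ⟨hu0, Eventually.of_forall hune⟩)
      simpa [Function.comp_def] using h2
  · filter_upwards [hdiff, hle] with x hx hxle z hz
    refine Complex.norm_deriv_le_of_forall_mem_sphere_norm_le (by positivity) ?_ ?_
    · refine DifferentiableOn.diffContOnCl ?_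
      rw [closure_ball _ (by positivity)]
      exact hx.mono (hsub z hz)
    · exact fun w hw => hxle w (hsub z hz (Metric.sphere_subset_closedBall hw))
  · filter_upwards [hdiff] with x hx z hz
    refine (hx.differentiableAt (Metric.isOpen_ball.mem_nhds ?_)).hasDerivAt
    exact hsub z hz (Metric.mem_closedBall_self (by positivity))

/-! ### Geometry of the Borel plane -/

theorem rayPoint_ne_zero (β : ℝ) {t : ℝ} (ht : 0 < t) : rayPoint β t ≠ 0 :=
  mul_ne_zero (Complex.ofReal_ne_zero.2 ht.ne') (Complex.exp_ne_zero _)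

theorem norm_rayPoint (β : ℝ) {t : ℝ} (ht : 0 ≤ t) : ‖rayPoint β t‖ = t := by
  rw [rayPoint, norm_mul, Complex.norm_exp_ofReal_mul_I, mul_one, Complex.norm_real,
    Real.norm_of_nonneg ht]

theorem re_rayPoint (β t : ℝ) : (rayPoint β t).re = t * Real.cos β := by
  simp [rayPoint, Complex.exp_ofReal_mul_I_re]

theorem im_rayPoint (β t : ℝ) : (rayPoint β t).im = t * Real.sin β := by
  simp [rayPoint, Complex.exp_ofReal_mul_I_im]

theorem arg_rayPoint {β t : ℝ} (hβ : |β| < Real.pi) (ht : 0 < t) :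
    (rayPoint β t).arg = β := by
  rw [abs_lt] at hβ
  rw [rayPoint, Complex.exp_mul_I, Complex.arg_mul_cos_add_sin_mul_I ht ⟨hβ.1, hβ.2.le⟩]

theorem rayPoint_arg_norm (w : ℂ) : rayPoint w.arg ‖w‖ = w := Complex.norm_mul_exp_arg_mul_I w

theorem mem_singularCut_iff {χ w : ℂ} (hχ : χ ≠ 0) :
    w ∈ singularCut χ ↔ 1 - w / χ ∉ Complex.slitPlane := by
  rw [Complex.mem_slitPlane_iff_not_le_zero, not_not, Complex.le_def]
  constructor
  · rintro ⟨t, ht, rfl⟩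
    rw [mul_div_cancel_right₀ _ hχ]
    simpa using ht
  · rintro ⟨h1, h2⟩
    refine ⟨(w / χ).re, by simpa using h1, ?_⟩
    have : ((w / χ).re : ℂ) = w / χ := Complex.ext (by simp) (by
      have h3 : (w / χ).im = 0 := by simpa using h2
      rw [Complex.ofReal_im, h3])
    rw [this, div_mul_cancel₀ _ hχ]

theorem arg_eq_of_mem_singularCut {χ w : ℂ} (h : w ∈ singularCut χ) : w.arg = χ.arg := by
  obtain ⟨t, ht, rfl⟩ := h
  exact Complex.arg_real_mul _ (by linarith)

theorem openSector_subset_slitPlane {δ : ℝ} (hδ : δ ≤ Real.pi / 2) :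
    openSector δ ⊆ Complex.slitPlane := by
  intro w hw
  rw [Complex.mem_slitPlane_iff_arg]
  refine ⟨fun h => ?_, hw.1⟩
  have h2 := hw.2
  rw [h, abs_of_pos Real.pi_pos] at h2
  linarith [Real.pi_pos]

theorem re_pos_of_mem_openSector {δ : ℝ} (hδ : δ ≤ Real.pi / 2) {χ : ℂ} (hχ : χ ∈ openSector δ) :
    0 < χ.re := by
  rw [← Complex.norm_mul_cos_arg χ]
  exact mul_pos (norm_pos_iff.2 hχ.1) (Real.cos_pos_of_mem_Ioo (abs_lt.1 (hχ.2.trans_le hδ)))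

theorem isOpen_openSector {δ : ℝ} (hδ : δ ≤ Real.pi / 2) : IsOpen (openSector δ) := by
  rw [isOpen_iff_mem_nhds]
  intro w hw
  have hc : ContinuousAt (fun w : ℂ => |w.arg|) w :=
    (Complex.continuousAt_arg (openSector_subset_slitPlane hδ hw)).abs
  filter_upwards [isOpen_ne.mem_nhds hw.1, hc.eventually_lt_const hw.2] with x h1 h2
  exact ⟨h1, h2⟩

theorem mem_borelDomain_iff {δ : ℝ} {χ w : ℂ} (hχ : χ ≠ 0) :
    w ∈ borelDomain δ χ ↔
      (‖w‖ < ‖χ‖ ∨ w ∈ openSector δ) ∧ 1 - w / χ ∈ Complex.slitPlane := by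
  rw [borelDomain, Set.mem_sdiff, mem_singularCut_iff hχ, not_not, mem_union, mem_ball_zero_iff]

/-- The domain of a parametric Borel transform is open. -/
theorem isOpen_setOf_mem_borelDomain {D : Set ℂ} (hD : IsOpen D) {δ : ℝ} (hδ : δ ≤ Real.pi / 2)
    {χ : ℂ → ℂ} (hχ : ContinuousOn χ D) (hχδ : ∀ z ∈ D, χ z ∈ openSector δ) :
    IsOpen {p : ℂ × ℂ | p.2 ∈ D ∧ p.1 ∈ borelDomain δ (χ p.2)} := by
  rw [isOpen_iff_mem_nhds]
  rintro ⟨w, z⟩ ⟨hz, hw⟩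
  have h0 := (hχδ z hz).1
  rw [mem_borelDomain_iff h0] at hw
  have hc : ContinuousAt (fun p : ℂ × ℂ => χ p.2) (w, z) :=
    ContinuousAt.comp (f := fun p : ℂ × ℂ => p.2) (x := (w, z))
      (hχ.continuousAt (hD.mem_nhds hz)) continuousAt_snd
  have hD' : ∀ᶠ p : ℂ × ℂ in 𝓝 (w, z), p.2 ∈ D :=
    continuousAt_snd.eventually (hD.mem_nhds hz)
  have hcut : ∀ᶠ p : ℂ × ℂ in 𝓝 (w, z), 1 - p.1 / χ p.2 ∈ Complex.slitPlane :=
    (continuousAt_const.sub (continuousAt_fst.div hc h0)).eventually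
      (Complex.isOpen_slitPlane.mem_nhds hw.2)
  have hor : ∀ᶠ p : ℂ × ℂ in 𝓝 (w, z), ‖p.1‖ < ‖χ p.2‖ ∨ p.1 ∈ openSector δ := by
    rcases hw.1 with h | h
    · filter_upwards [continuousAt_fst.norm.eventually_lt hc.norm h] with p hp using Or.inl hp
    · filter_upwards [continuousAt_fst.eventually ((isOpen_openSector hδ).mem_nhds h)] with p hp
        using Or.inr hp
  filter_upwards [hD', hcut, hor] with p h1 h2 h3
  exact ⟨h1, (mem_borelDomain_iff (hχδ _ h1).1).2 ⟨h3, h2⟩⟩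

theorem isOpen_borelDomain {δ : ℝ} (hδ : δ ≤ Real.pi / 2) {χ : ℂ} (hχ : χ ∈ openSector δ) :
    IsOpen (borelDomain δ χ) := by
  have h := (isOpen_setOf_mem_borelDomain isOpen_univ hδ (χ := fun _ => χ) continuousOn_const
    (fun _ _ => hχ)).preimage (Continuous.prodMk_left (0 : ℂ))
  convert h using 1
  ext w
  simp

theorem one_sub_smul_div_mem_slitPlane {χ w : ℂ} (h : 1 - w / χ ∈ Complex.slitPlane) {t : ℝ}
    (ht0 : 0 ≤ t) (ht1 : t ≤ 1) : 1 - t • w / χ ∈ Complex.slitPlane := by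
  rcases ht0.eq_or_lt with rfl | ht
  · simp
  · rcases ht1.eq_or_lt with rfl | ht1'
    · simpa using h
    · have := (starConvex_iff_forall_pos (by simp)).1 Complex.starConvex_one_slitPlane h
        (sub_pos.2 ht1') ht (by ring)
      convert this using 1
      simp only [Complex.real_smul]
      push_cast
      ring

theorem starConvex_borelDomain {δ : ℝ} {χ : ℂ} (hχ : χ ∈ openSector δ) :
    StarConvex ℝ 0 (borelDomain δ χ) := by
  have h0 := hχ.1
  rw [starConvex_zero_iff]
  intro w hw t ht0 ht1
  rw [mem_borelDomain_iff h0] at hw ⊢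
  refine ⟨?_, ?_⟩
  · rcases ht0.eq_or_lt with rfl | ht
    · left
      simpa using h0
    · rcases hw.1 with h | h
      · left
        rw [norm_smul, Real.norm_of_nonneg ht0]
        exact (mul_le_of_le_one_left (norm_nonneg _) ht1).trans_lt h
      · right
        refine ⟨smul_ne_zero ht.ne' h.1, ?_⟩
        rw [Complex.real_smul, Complex.arg_real_mul _ ht]
        exact h.2
  · exact one_sub_smul_div_mem_slitPlane hw.2 ht0 ht1

theorem ball_subset_borelDomain {δ : ℝ} {χ : ℂ} (hχ : χ ∈ openSector δ) :
    Metric.ball 0 ‖χ‖ ⊆ borelDomain δ χ := by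
  intro w hw
  refine ⟨Or.inl hw, ?_⟩
  rintro ⟨t, ht, rfl⟩
  rw [mem_ball_zero_iff, norm_mul, Complex.norm_real, Real.norm_of_nonneg (by linarith)] at hw
  nlinarith [norm_pos_iff.2 hχ.1]

theorem rayPoint_mem_borelDomain {δ : ℝ} (hδ : δ ≤ Real.pi / 2) {χ : ℂ}
    {β t : ℝ} (hβ : |β| < δ) (hne : β ≠ χ.arg) (ht : 0 < t) :
    rayPoint β t ∈ borelDomain δ χ := by
  have harg : (rayPoint β t).arg = β :=
    arg_rayPoint (hβ.trans_le (by linarith [Real.pi_pos])) ht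
  refine ⟨Or.inr ⟨rayPoint_ne_zero β ht, by rwa [harg]⟩, fun h => hne ?_⟩
  rw [← arg_eq_of_mem_singularCut h, harg]

/-- Polar form of a point of the convex cone spanned by two directions of the right half-plane. -/
theorem exists_polar_of_combination {β₁ β₂ a b : ℝ} (h₁ : |β₁| < Real.pi / 2)
    (h₂ : |β₂| < Real.pi / 2) (ha : 0 ≤ a) (hb : 0 ≤ b) (hab : 0 < a + b) :
    ∃ β ∈ uIcc β₁ β₂, rayPoint β₁ a + rayPoint β₂ b =
        rayPoint β ‖rayPoint β₁ a + rayPoint β₂ b‖ ∧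
      ‖rayPoint β₁ a + rayPoint β₂ b‖ * Real.sin (β - β₁) = b * Real.sin (β₂ - β₁) := by
  set w := rayPoint β₁ a + rayPoint β₂ b with hw
  have hre : w.re = a * Real.cos β₁ + b * Real.cos β₂ := by simp [hw, re_rayPoint]
  have him : w.im = a * Real.sin β₁ + b * Real.sin β₂ := by simp [hw, im_rayPoint]
  rw [abs_lt] at h₁ h₂
  have hc1 := Real.cos_pos_of_mem_Ioo (x := β₁) ⟨by linarith, by linarith⟩
  have hc2 := Real.cos_pos_of_mem_Ioo (x := β₂) ⟨by linarith, by linarith⟩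
  have hre0 : 0 < w.re := by
    rw [hre]
    rcases ha.eq_or_lt with rfl | ha'
    · have : 0 < b := by linarith
      positivity
    · positivity
  have hw0 : 0 < ‖w‖ := norm_pos_iff.2 (fun h => by simp [h] at hre0)
  have harg := Complex.abs_arg_lt_pi_div_two_iff.2 (Or.inl hre0)
  rw [abs_lt] at harg
  have hwe := rayPoint_arg_norm w
  have e1 : w.re = ‖w‖ * Real.cos w.arg := by rw [← re_rayPoint, hwe]
  have e2 : w.im = ‖w‖ * Real.sin w.arg := by rw [← im_rayPoint, hwe]
  have s1 : ‖w‖ * Real.sin (w.arg - β₁) = b * Real.sin (β₂ - β₁) := by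
    rw [Real.sin_sub, Real.sin_sub]
    linear_combination (-Real.cos β₁) * e2 + Real.sin β₁ * e1 + Real.cos β₁ * him
      - Real.sin β₁ * hre
  have s2 : ‖w‖ * Real.sin (β₂ - w.arg) = a * Real.sin (β₂ - β₁) := by
    rw [Real.sin_sub, Real.sin_sub]
    linear_combination (-Real.sin β₂) * e1 + Real.cos β₂ * e2 + Real.sin β₂ * hre
      - Real.cos β₂ * him
  refine ⟨w.arg, ?_, hwe.symm, s1⟩
  -- the sign of `sin x` is the sign of `x` for `|x| < π`
  have sgn : ∀ x : ℝ, -Real.pi < x → ‖w‖ * Real.sin x ≥ 0 → x < Real.pi → 0 ≤ x := by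
    intro x hx h _
    by_contra hneg
    push Not at hneg
    have := Real.sin_neg_of_neg_of_neg_pi_lt hneg hx
    nlinarith
  have pos : ∀ x : ℝ, 0 ≤ x → x < Real.pi → 0 ≤ Real.sin x :=
    fun x h h' => Real.sin_nonneg_of_nonneg_of_le_pi h h'.le
  rcases le_total β₁ β₂ with h | h
  · rw [uIcc_of_le h]
    have hp := pos (β₂ - β₁) (by linarith) (by linarith)
    constructor
    · linarith [sgn (w.arg - β₁) (by linarith) (by rw [s1]; positivity) (by linarith)]
    · linarith [sgn (β₂ - w.arg) (by linarith) (by rw [s2]; positivity) (by linarith)]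
  · rw [uIcc_of_ge h]
    have hp := pos (β₁ - β₂) (by linarith) (by linarith)
    have q1 : Real.sin (β₂ - β₁) = -Real.sin (β₁ - β₂) := by rw [← Real.sin_neg]; ring_nf
    have q2 : Real.sin (β₁ - w.arg) = -Real.sin (w.arg - β₁) := by rw [← Real.sin_neg]; ring_nf
    have q3 : Real.sin (w.arg - β₂) = -Real.sin (β₂ - w.arg) := by rw [← Real.sin_neg]; ring_nf
    constructor
    · linarith [sgn (w.arg - β₂) (by linarith) (by rw [q3]; nlinarith) (by linarith)]
    · linarith [sgn (β₁ - w.arg) (by linarith) (by rw [q2]; nlinarith) (by linarith)]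

/-! ### Hankel's formula for `1 / Γ` -/

theorem norm_cpow_neg_le {z : ℂ} (hz : z ≠ 0) (α : ℂ) :
    ‖z ^ (-α)‖ ≤ Real.exp (Real.pi * |α.im|) * ‖z‖ ^ (-α.re) := by
  rw [Complex.norm_cpow_of_ne_zero hz, Complex.neg_re, div_eq_mul_inv, ← Real.exp_neg, mul_comm]
  gcongr
  rw [Complex.neg_im, mul_neg, neg_neg]
  refine (le_abs_self _).trans ?_
  rw [abs_mul]
  gcongr
  exact Complex.abs_arg_le_pi z

theorem integrableOn_rpow_mul_exp_neg {a c : ℝ} (ha : 0 < a) (hc : 0 < c) :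
    IntegrableOn (fun t : ℝ => t ^ (a - 1) * Real.exp (-(c * t))) (Ioi 0) := by
  have := integrableOn_rpow_mul_exp_neg_mul_rpow (p := 1) (s := a - 1) (b := c) (by linarith)
    one_pos hc
  simpa [neg_mul] using this

theorem aestronglyMeasurable_cpow_mul_exp (α r : ℂ) :
    AEStronglyMeasurable (fun t : ℝ => (t : ℂ) ^ (α - 1) * Complex.exp (-(r * t)))
      (volume.restrict (Ioi 0)) := by
  refine ContinuousOn.aestronglyMeasurable ?_ measurableSet_Ioi
  intro t ht
  refine ContinuousAt.continuousWithinAt ?_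
  refine ContinuousAt.mul ?_ (by fun_prop)
  exact (Complex.continuousAt_ofReal_cpow_const t (α - 1) (Or.inr (ne_of_gt ht)))

theorem norm_cpow_mul_exp {α r : ℂ} {t : ℝ} (ht : 0 < t) :
    ‖(t : ℂ) ^ (α - 1) * Complex.exp (-(r * t))‖ = t ^ (α.re - 1) * Real.exp (-(r.re * t)) := by
  rw [norm_mul, Complex.norm_cpow_eq_rpow_re_of_pos ht, Complex.norm_exp]
  simp

theorem integrableOn_cpow_mul_exp {α r : ℂ} (hα : 0 < α.re) (hr : 0 < r.re) :
    IntegrableOn (fun t : ℝ => (t : ℂ) ^ (α - 1) * Complex.exp (-(r * t))) (Ioi 0) := by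
  refine Integrable.mono' (integrableOn_rpow_mul_exp_neg hα hr)
    (aestronglyMeasurable_cpow_mul_exp α r) ?_
  filter_upwards [ae_restrict_mem measurableSet_Ioi] with t ht
  exact (norm_cpow_mul_exp ht).le

/-- Euler's integral with a complex rate, from the case of a positive rate by the identity
theorem. -/
theorem integral_cpow_mul_exp_neg_complex {α r : ℂ} (hα : 0 < α.re) (hr : 0 < r.re) :
    ∫ t in Ioi (0 : ℝ), (t : ℂ) ^ (α - 1) * Complex.exp (-(r * t)) =
      r ^ (-α) * Complex.Gamma α := by
  set U : Set ℂ := {r | 0 < r.re} with hU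
  have hUo : IsOpen U := isOpen_lt continuous_const Complex.continuous_re
  have hUc : IsPreconnected U := (convex_halfSpace_re_gt 0).isPreconnected
  have h1 : AnalyticOnNhd ℂ
      (fun r : ℂ => ∫ t in Ioi (0 : ℝ), (t : ℂ) ^ (α - 1) * Complex.exp (-(r * t))) U := by
    refine DifferentiableOn.analyticOnNhd (fun z hz => ?_) hUo
    refine DifferentiableAt.differentiableWithinAt ?_
    have hz2 : 0 < z.re / 2 := half_pos hz
    refine differentiableAt_integral_of_norm_le hz2 (integrableOn_rpow_mul_exp_neg hα hz2)
      (fun w _ => aestronglyMeasurable_cpow_mul_exp α w) ?_ ?_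
    · refine Eventually.of_forall fun t => Differentiable.differentiableOn ?_
      fun_prop
    · filter_upwards [ae_restrict_mem measurableSet_Ioi] with t ht w hw
      rw [norm_cpow_mul_exp ht]
      have : z.re / 2 ≤ w.re := by
        have h2 := (Complex.abs_re_le_norm (w - z)).trans_lt (mem_ball_iff_norm.1 hw)
        rw [Complex.sub_re, abs_lt] at h2
        linarith
      have ht' : (0 : ℝ) < t := ht
      gcongr
  have h2 : AnalyticOnNhd ℂ (fun r : ℂ => r ^ (-α) * Complex.Gamma α) U := by
    refine DifferentiableOn.analyticOnNhd (fun z hz => ?_) hUo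
    refine DifferentiableAt.differentiableWithinAt ?_
    exact (differentiableAt_id.cpow_const (Or.inl hz)).mul_const _
  have h3 := h1.eqOn_of_preconnected_of_frequently_eq h2 hUc (z₀ := 1) (by simp [hU]) ?_
  · exact h3 hr
  · have ht : Tendsto (fun t : ℝ => (t : ℂ)) (𝓝[≠] 1) (𝓝[≠] 1) := by
      refine tendsto_nhdsWithin_iff.2 ⟨?_, ?_⟩
      · exact (Complex.continuous_ofReal.tendsto' 1 1 (by simp)).mono_left nhdsWithin_le_nhds
      · filter_upwards [self_mem_nhdsWithin] with t ht
        simpa using ht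
    refine ht.frequently (Eventually.frequently ?_)
    filter_upwards [mem_nhdsWithin_of_mem_nhds (Ioi_mem_nhds (zero_lt_one' ℝ))] with t ht
    rw [Complex.integral_cpow_mul_exp_neg_mul_Ioi hα ht, one_div, Complex.inv_cpow,
      Complex.cpow_neg]
    rw [Complex.arg_ofReal_of_nonneg (le_of_lt ht)]
    exact Real.pi_pos.ne

theorem continuous_cpow_vertical {χ : ℂ} (hχ : 0 < χ.re) (α : ℂ) (k : ℝ) :
    Continuous (fun s : ℝ => (χ + (k * s : ℝ) * Complex.I) ^ (-α)) := by
  refine Continuous.cpow (by fun_prop) continuous_const fun s => Or.inl ?_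
  simpa using hχ

theorem integrable_cpow_vertical {χ : ℂ} (hχ : 0 < χ.re) {α : ℂ} (hα : 1 < α.re) {k : ℝ}
    (hk : 0 < k) :
    Integrable (fun s : ℝ => (χ + (k * s : ℝ) * Complex.I) ^ (-α)) := by
  -- `1 + |s| ≤ M |χ + i k s|`
  set M : ℝ := (1 + ‖χ‖ / k) / χ.re + 1 / k with hM
  have hM0 : 0 < M := by positivity
  have hlow : ∀ s : ℝ, M⁻¹ * (1 + ‖s‖) ≤ ‖χ + (k * s : ℝ) * Complex.I‖ := by
    intro s
    rw [inv_mul_le_iff₀ hM0]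
    set w := χ + (k * s : ℝ) * Complex.I with hw
    have h1 : χ.re ≤ ‖w‖ := by
      have := Complex.re_le_norm w
      simpa [hw] using this
    have h2 : k * ‖s‖ ≤ ‖w‖ + ‖χ‖ := by
      have : ((k * s : ℝ) : ℂ) * Complex.I = w - χ := by rw [hw]; ring
      have h3 := congrArg norm this
      rw [norm_mul, Complex.norm_I, mul_one, Complex.norm_real, norm_mul, Real.norm_of_nonneg hk.le]
        at h3
      rw [h3]
      exact norm_sub_le _ _
    have h4 : ‖s‖ ≤ ‖w‖ / k + ‖χ‖ / k := by
      rw [← add_div, le_div_iff₀ hk]; linarith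
    have h5 : 1 + ‖χ‖ / k ≤ (1 + ‖χ‖ / k) / χ.re * ‖w‖ := by
      rw [div_mul_eq_mul_div, le_div_iff₀ hχ]
      gcongr
    rw [hM, add_mul, one_div_mul_eq_div]
    linarith
  have hI := (integrable_one_add_norm (E := ℝ) (μ := volume) (r := α.re)
    (by simpa using hα)).const_mul
    (Real.exp (Real.pi * |α.im|) * M⁻¹ ^ (-α.re))
  refine hI.mono' (continuous_cpow_vertical hχ α k).aestronglyMeasurable ?_
  refine Eventually.of_forall fun s => ?_
  have hpos : 0 < M⁻¹ * (1 + ‖s‖) := by positivity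
  refine (norm_cpow_neg_le (norm_pos_iff.1 (hpos.trans_le (hlow s))) α).trans ?_
  rw [mul_assoc, ← Real.mul_rpow (by positivity) (by positivity)]
  gcongr ?_ * ?_
  exact Real.rpow_le_rpow_of_nonpos hpos (hlow s) (by linarith)

open scoped FourierTransform in
/-- Laplace's form of Hankel's formula for `1 / Γ`, on the vertical line through `χ`: it is Fourier
inversion at `1` for the function `x ^ (α - 1) * exp (-χ x)` on the half-line. -/
theorem integral_exp_mul_cpow_vertical {χ : ℂ} (hχ : 0 < χ.re) {α : ℂ} (hα : 1 < α.re) :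
    ∫ s : ℝ, Complex.exp (s * Complex.I) * (χ + s * Complex.I) ^ (-α) =
      2 * Real.pi * Complex.exp (-χ) / Complex.Gamma α := by
  have hα0 : 0 < α.re := by linarith
  have hΓ : Complex.Gamma α ≠ 0 := Complex.Gamma_ne_zero_of_re_pos hα0
  set f : ℝ → ℂ := (Ioi (0 : ℝ)).indicator
    (fun t : ℝ => (t : ℂ) ^ (α - 1) * Complex.exp (-(χ * t))) with hf
  have hfint : Integrable f := (integrableOn_cpow_mul_exp hα0 hχ).integrable_indicator
    measurableSet_Ioi
  have hF : 𝓕 f = fun ξ : ℝ =>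
      (χ + (2 * Real.pi * ξ : ℝ) * Complex.I) ^ (-α) * Complex.Gamma α := by
    ext ξ
    rw [Real.fourier_real_eq_integral_exp_smul, ← integral_cpow_mul_exp_neg_complex hα0 (by simpa),
      ← integral_indicator measurableSet_Ioi]
    congr 1
    ext t
    rw [hf]
    by_cases ht : t ∈ Ioi (0 : ℝ)
    · rw [indicator_of_mem ht, indicator_of_mem ht, smul_eq_mul, mul_left_comm, ← Complex.exp_add]
      congr 2
      push_cast
      ring
    · rw [indicator_of_notMem ht, indicator_of_notMem ht, smul_zero]
  have hFint : Integrable (𝓕 f) := by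
    rw [hF]
    exact (integrable_cpow_vertical hχ hα (by positivity)).mul_const _
  have hcont : ContinuousAt f 1 := by
    have h1 : ContinuousAt (fun t : ℝ => (t : ℂ) ^ (α - 1) * Complex.exp (-(χ * t))) 1 := by
      refine ContinuousAt.mul ?_ (by fun_prop)
      exact Complex.continuousAt_ofReal_cpow_const 1 (α - 1) (Or.inr one_ne_zero)
    refine h1.congr ?_
    filter_upwards [Ioi_mem_nhds (zero_lt_one' ℝ)] with t ht
    rw [hf, indicator_of_mem ht]
  have hinv := hfint.fourierInv_fourier_eq hFint hcont
  rw [hF, Real.fourierInv_eq'] at hinv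
  have hf1 : f 1 = Complex.exp (-χ) := by
    rw [hf, indicator_of_mem (by simp)]
    simp
  rw [hf1] at hinv
  have hsub := Measure.integral_comp_mul_left
    (fun s : ℝ => Complex.exp (s * Complex.I) * (χ + s * Complex.I) ^ (-α)) (2 * Real.pi)
  have hlhs : ∫ x : ℝ, Complex.exp (((2 * Real.pi * x : ℝ) : ℂ) * Complex.I) *
      (χ + ((2 * Real.pi * x : ℝ) : ℂ) * Complex.I) ^ (-α) =
      Complex.exp (-χ) / Complex.Gamma α := by
    rw [eq_div_iff hΓ, ← hinv, ← integral_mul_const]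
    congr 1
    ext x
    rw [smul_eq_mul, mul_assoc]
    congr 3
    simp
  rw [hlhs, abs_of_pos (by positivity), Complex.real_smul] at hsub
  have hpi : (Real.pi : ℂ) ≠ 0 := Complex.ofReal_ne_zero.2 Real.pi_ne_zero
  generalize (∫ s : ℝ, Complex.exp (s * Complex.I) * (χ + s * Complex.I) ^ (-α)) = X at hsub ⊢
  rw [mul_div_assoc, hsub]
  push_cast
  field_simp

/-- One arm of the Hankel contour for `∫ exp (-w) (1 - w / χ) ^ (-α) dw`: the ray from `0` in the
direction `d`. -/
noncomputable def hankelRay (χ α d : ℂ) : ℂ :=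
  ∫ s in Ioi (0 : ℝ), Complex.exp (-(s * d)) * (1 - s * d / χ) ^ (-α) * d

theorem im_div_eq (w χ : ℂ) :
    (w / χ).im = (w * (starRingEnd ℂ) χ).im / Complex.normSq χ := by
  rw [Complex.div_im, Complex.mul_im, Complex.conj_re, Complex.conj_im]
  ring

theorem one_sub_div_mem_slitPlane {σ : ℝ} {χ d : ℂ} (hχ : χ ≠ 0)
    (hd : 0 < σ * (d * (starRingEnd ℂ) χ).im) {s : ℝ} (hs : 0 ≤ s) :
    1 - s * d / χ ∈ Complex.slitPlane := by
  rcases hs.eq_or_lt with rfl | hs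
  · simp
  · right
    have h1 : (d * (starRingEnd ℂ) χ).im ≠ 0 := by
      rintro h
      rw [h, mul_zero] at hd
      exact hd.false
    have h2 : (s * d / χ).im = s * ((d * (starRingEnd ℂ) χ).im / Complex.normSq χ) := by
      rw [mul_div_assoc, Complex.im_ofReal_mul, im_div_eq]
    rw [Complex.sub_im, Complex.one_im, zero_sub, h2]
    exact neg_ne_zero.2 (mul_ne_zero hs.ne' (div_ne_zero h1 (by simpa using hχ)))

/-- Bound for the integrand of the Hankel contour far from `χ`; there `s * k` is a lower bound for
`‖w‖`. -/
theorem norm_hankel_le {χ α w : ℂ} (hχ : χ ≠ 0) (hα : 0 ≤ α.re) (hw : 0 ≤ w.re) {k s : ℝ}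
    (hk : s * k ≤ ‖w‖) (hs : 2 * ‖χ‖ ≤ s * k) (hsk : 0 < s * k) :
    ‖Complex.exp (-w) * (1 - w / χ) ^ (-α)‖ ≤
      Real.exp (Real.pi * |α.im|) * (s * k / (2 * ‖χ‖)) ^ (-α.re) := by
  have hχ' := norm_pos_iff.2 hχ
  have h1 : s * k / (2 * ‖χ‖) ≤ ‖1 - w / χ‖ := by
    have h2 : ‖w / χ‖ - 1 ≤ ‖1 - w / χ‖ := by
      have := norm_sub_norm_le (w / χ) 1
      rwa [norm_one, norm_sub_rev] at this
    refine le_trans ?_ h2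
    rw [norm_div]
    have h3 : 1 ≤ s * k / (2 * ‖χ‖) := by rwa [le_div_iff₀ (by positivity), one_mul]
    have h4 : s * k / ‖χ‖ = 2 * (s * k / (2 * ‖χ‖)) := by field_simp
    have h5 : s * k / ‖χ‖ ≤ ‖w‖ / ‖χ‖ := by gcongr
    linarith
  have hpos : 0 < s * k / (2 * ‖χ‖) := by positivity
  rw [norm_mul]
  have he : ‖Complex.exp (-w)‖ ≤ 1 := by
    rw [Complex.norm_exp, Complex.neg_re]
    exact Real.exp_le_one_iff.2 (by linarith)
  refine (mul_le_of_le_one_left (norm_nonneg _) he).trans ?_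
  refine (norm_cpow_neg_le (norm_pos_iff.1 (hpos.trans_le h1)) α).trans ?_
  gcongr ?_ * ?_
  exact Real.rpow_le_rpow_of_nonpos hpos h1 (by linarith)

theorem integrableOn_hankelRay {σ : ℝ} {χ α d : ℂ} (hχ : χ ≠ 0) (hα : 1 < α.re)
    (hd : 0 < σ * (d * (starRingEnd ℂ) χ).im) (hre : 0 ≤ d.re) :
    IntegrableOn (fun s : ℝ => Complex.exp (-(s * d)) * (1 - s * d / χ) ^ (-α) * d) (Ioi 0) := by
  have hd0 : d ≠ 0 := by
    rintro rfl
    simp at hd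
  have hk : 0 < ‖d‖ := norm_pos_iff.2 hd0
  have hcont : ContinuousOn
      (fun s : ℝ => Complex.exp (-(s * d)) * (1 - s * d / χ) ^ (-α) * d) (Ici 0) := by
    refine ContinuousOn.mul (ContinuousOn.mul (by fun_prop) ?_) continuousOn_const
    exact ContinuousOn.cpow (by fun_prop) continuousOn_const
      fun s hs => one_sub_div_mem_slitPlane hχ hd hs
  set S : ℝ := 2 * ‖χ‖ / ‖d‖ with hS
  have hS0 : 0 < S := by have := norm_pos_iff.2 hχ; positivity
  rw [← Ioc_union_Ioi_eq_Ioi hS0.le]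
  refine IntegrableOn.union ?_ ?_
  · exact ((hcont.mono Icc_subset_Ici_self).integrableOn_Icc).mono_set Ioc_subset_Icc_self
  · have hI := (integrableOn_Ioi_rpow_of_lt (a := -α.re) (by linarith) hS0).const_mul
      (Real.exp (Real.pi * |α.im|) * (‖d‖ / (2 * ‖χ‖)) ^ (-α.re) * ‖d‖)
    refine hI.mono' ((hcont.mono ?_).aestronglyMeasurable measurableSet_Ioi) ?_
    · exact (Ioi_subset_Ioi hS0.le).trans Ioi_subset_Ici_self
    · filter_upwards [ae_restrict_mem measurableSet_Ioi] with s hs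
      have hs' : S < s := hs
      have hs0 : 0 < s := hS0.trans hs'
      have h1 := norm_hankel_le (χ := χ) (α := α) (w := s * d) (k := ‖d‖) (s := s) hχ
        (by linarith) ?_ ?_ ?_ (by positivity)
      · rw [norm_mul]
        refine (mul_le_mul_of_nonneg_right h1 (norm_nonneg d)).trans (le_of_eq ?_)
        rw [mul_div_assoc, Real.mul_rpow hs0.le (by positivity)]
        ring
      · rw [Complex.re_ofReal_mul]
        positivity
      · rw [norm_mul, Complex.norm_real, Real.norm_of_nonneg hs0.le]
      · rw [hS, div_lt_iff₀ hk] at hs'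
        exact hs'.le

/-- The arms of the Hankel contour can be turned up to the vertical: the integrand decays like
`|w| ^ (-Re α)` with `Re α > 1`. Here `σ` is the side of the cut on which both arms lie. -/
theorem hankelRay_eq {σ : ℝ} {χ α d₁ d₂ : ℂ} (hσ : |σ| = 1) (hχ : χ ≠ 0) (hα : 1 < α.re)
    (hd₁ : 0 < σ * (d₁ * (starRingEnd ℂ) χ).im) (hre₁ : 0 ≤ d₁.re) (him₁ : 0 < σ * d₁.im)
    (hd₂ : 0 < σ * (d₂ * (starRingEnd ℂ) χ).im) (hre₂ : 0 ≤ d₂.re) (him₂ : 0 < σ * d₂.im) :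
    hankelRay χ α d₁ = hankelRay χ α d₂ := by
  set U : Set ℂ := {w | 1 - w / χ ∈ Complex.slitPlane} with hU
  have hUo : IsOpen U := Complex.isOpen_slitPlane.preimage (by fun_prop)
  have hUs : StarConvex ℝ 0 U := by
    rw [starConvex_zero_iff]
    exact fun w hw t h0 h1 => one_sub_smul_div_mem_slitPlane hw h0 h1
  set G : ℂ → ℂ := fun w => Complex.exp (-w) * (1 - w / χ) ^ (-α) with hG
  have hGd : DifferentiableOn ℂ G U := by
    intro w hw
    refine DifferentiableAt.differentiableWithinAt ?_
    refine DifferentiableAt.mul (by fun_prop) ?_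
    exact DifferentiableAt.cpow_const (by fun_prop) hw
  obtain ⟨P, hP⟩ := exists_primitive_of_starConvex hUo hUs hGd
  set k : ℝ := min (σ * d₁.im) (σ * d₂.im) with hk
  have hk0 : 0 < k := lt_min him₁ him₂
  have hb : Tendsto (fun s : ℝ => (Real.exp (Real.pi * |α.im|) * (s * k / (2 * ‖χ‖)) ^ (-α.re)) *
      (1 + s)) atTop (𝓝 0) := by
    have h1 := tendsto_rpow_neg_atTop (show 0 < α.re by linarith)
    have h2 := tendsto_rpow_neg_atTop (show 0 < α.re - 1 by linarith)
    have h3 := (h1.add h2).const_mul (Real.exp (Real.pi * |α.im|) * (k / (2 * ‖χ‖)) ^ (-α.re))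
    rw [add_zero, mul_zero] at h3
    refine h3.congr' ?_
    filter_upwards [eventually_gt_atTop 0] with s hs
    rw [mul_div_assoc, Real.mul_rpow hs.le (by positivity),
      show -(α.re - 1) = -α.re + 1 by ring, Real.rpow_add hs, Real.rpow_one]
    ring
  have key := integral_ray_eq_of_primitive (P := P) (G := G) (v₁ := 0) (d₁ := d₁) (v₂ := 0)
    (d₂ := d₂) ?_ ?_ ?_ ?_ hb ?_
  · simpa [hankelRay, hG] using key
  · intro s hs
    rw [zero_add]
    exact hP _ (one_sub_div_mem_slitPlane hχ hd₁ hs)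
  · intro s hs
    rw [zero_add]
    exact hP _ (one_sub_div_mem_slitPlane hχ hd₂ hs)
  · simpa [hG] using integrableOn_hankelRay hχ hα hd₁ hre₁
  · simpa [hG] using integrableOn_hankelRay hχ hα hd₂ hre₂
  · filter_upwards [eventually_gt_atTop 0, eventually_ge_atTop (2 * ‖χ‖ / k)] with s hs hsk w hw
    obtain ⟨a, b, ha, hb, hab, rfl⟩ := hw
    set e : ℂ := a * d₁ + b * d₂ with he
    have hwe : a • (0 + (s : ℂ) * d₁) + b • (0 + (s : ℂ) * d₂) = s * e := by
      rw [he, Complex.real_smul, Complex.real_smul]; ring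
    rw [hwe]
    -- the conditions on the directions are convex
    have comb : ∀ x y m : ℝ, m ≤ x → m ≤ y → m ≤ a * x + b * y := by
      intro x y m hx hy
      calc m = a * m + b * m := by rw [← add_mul, hab, one_mul]
        _ ≤ a * x + b * y := by gcongr
    have h1 : 0 < σ * (e * (starRingEnd ℂ) χ).im := by
      have h2 := comb _ _ _ (min_le_left (σ * (d₁ * (starRingEnd ℂ) χ).im)
        (σ * (d₂ * (starRingEnd ℂ) χ).im)) (min_le_right _ _)
      refine (lt_min hd₁ hd₂).trans_le (h2.trans (le_of_eq ?_))
      rw [he, add_mul, Complex.add_im, mul_assoc, mul_assoc, Complex.im_ofReal_mul,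
        Complex.im_ofReal_mul]
      ring
    have h3 : k ≤ σ * e.im := by
      have h2 := comb _ _ _ (min_le_left (σ * d₁.im) (σ * d₂.im)) (min_le_right _ _)
      refine h2.trans (le_of_eq ?_)
      rw [he, Complex.add_im, Complex.im_ofReal_mul, Complex.im_ofReal_mul]
      ring
    have h4 : 0 ≤ e.re := by
      have h2 := comb _ _ 0 hre₁ hre₂
      rw [he, Complex.add_re, Complex.re_ofReal_mul, Complex.re_ofReal_mul]
      exact h2
    refine ⟨hP _ (one_sub_div_mem_slitPlane hχ h1 hs.le), ?_⟩
    refine norm_hankel_le hχ (by linarith) ?_ ?_ ?_ (by positivity)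
    · rw [Complex.re_ofReal_mul]; positivity
    · rw [norm_mul, Complex.norm_real, Real.norm_of_nonneg hs.le]
      gcongr
      refine h3.trans ((le_abs_self _).trans ?_)
      rw [abs_mul, hσ, one_mul]
      exact Complex.abs_im_le_norm e
    · rwa [div_le_iff₀ hk0] at hsk

/-- Hankel's formula in the form needed for the jump: the contour has its vertex at `0` and
encloses the cut from `χ` outwards. -/
theorem hankelRay_sub_hankelRay {χ α : ℂ} (hχ : 0 < χ.re) (hα : 1 < α.re) {θ : ℝ}
    (hθχ : |χ.arg| < θ) (hθ : θ < Real.pi / 2) :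
    hankelRay χ α (Complex.exp (θ * Complex.I)) -
        hankelRay χ α (Complex.exp ((-θ : ℝ) * Complex.I)) =
      Complex.exp (-χ) * (2 * Real.pi * Complex.I * χ ^ α / Complex.Gamma α) := by
  have hχ0 : χ ≠ 0 := by
    rintro rfl
    simp at hχ
  have hθ0 : 0 < θ := (abs_nonneg _).trans_lt hθχ
  have hcos : 0 < Real.cos θ := Real.cos_pos_of_mem_Ioo ⟨by linarith, hθ⟩
  have hsin : 0 < Real.sin θ := Real.sin_pos_of_pos_of_lt_pi hθ0 (by linarith [Real.pi_pos])
  have hn : 0 < ‖χ‖ := norm_pos_iff.2 hχ0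
  have e1 : χ.re = ‖χ‖ * Real.cos χ.arg := (Complex.norm_mul_cos_arg χ).symm
  have e2 : χ.im = ‖χ‖ * Real.sin χ.arg := (Complex.norm_mul_sin_arg χ).symm
  rw [abs_lt] at hθχ
  have s1 : 0 < Real.sin (θ - χ.arg) :=
    Real.sin_pos_of_pos_of_lt_pi (by linarith) (by linarith)
  have s2 : 0 < Real.sin (θ + χ.arg) :=
    Real.sin_pos_of_pos_of_lt_pi (by linarith) (by linarith)
  have hup : hankelRay χ α (Complex.exp (θ * Complex.I)) = hankelRay χ α Complex.I := by
    refine hankelRay_eq (σ := 1) (by simp) hχ0 hα ?_ ?_ ?_ ?_ ?_ ?_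
    · rw [one_mul, Complex.mul_im, Complex.exp_ofReal_mul_I_re, Complex.exp_ofReal_mul_I_im,
        Complex.conj_re, Complex.conj_im, e1, e2]
      rw [Real.sin_sub] at s1
      nlinarith
    · rw [Complex.exp_ofReal_mul_I_re]; exact hcos.le
    · rw [Complex.exp_ofReal_mul_I_im]; linarith
    · simpa using hχ
    · simp
    · simp
  have hdown : hankelRay χ α (Complex.exp ((-θ : ℝ) * Complex.I)) =
      hankelRay χ α (-Complex.I) := by
    refine hankelRay_eq (σ := -1) (by simp) hχ0 hα ?_ ?_ ?_ ?_ ?_ ?_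
    · rw [Complex.mul_im, Complex.exp_ofReal_mul_I_re, Complex.exp_ofReal_mul_I_im,
        Complex.conj_re, Complex.conj_im, Real.cos_neg, Real.sin_neg, e1, e2]
      rw [Real.sin_add] at s2
      nlinarith
    · rw [Complex.exp_ofReal_mul_I_re, Real.cos_neg]; exact hcos.le
    · rw [Complex.exp_ofReal_mul_I_im, Real.sin_neg]; linarith
    · simpa using hχ
    · simp
    · simp
  rw [hup, hdown]
  -- the two vertical arms together form the line `Re (χ - w) = Re χ`
  set q : ℝ → ℂ := fun s => Complex.exp (s * Complex.I) * (1 + s * Complex.I / χ) ^ (-α) with hq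
  have hq2 : ∀ s : ℝ, q s =
      χ ^ α * (Complex.exp (s * Complex.I) * (χ + s * Complex.I) ^ (-α)) := by
    intro s
    have hre : 0 < (χ + s * Complex.I).re := by simpa using hχ
    have hne : χ + s * Complex.I ≠ 0 := fun h => by simp [h] at hre
    have h1 : 1 + s * Complex.I / χ = (χ + s * Complex.I) / χ := by field_simp
    have ha1 := Complex.abs_arg_lt_pi_div_two_iff.2 (Or.inl hre)
    have ha2 := Complex.abs_arg_lt_pi_div_two_iff.2 (Or.inl hχ)
    rw [abs_lt] at ha1 ha2
    have h2 : ((χ + s * Complex.I) / χ) ^ (-α) = (χ + s * Complex.I) ^ (-α) / χ ^ (-α) := by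
      have h3 : Complex.log ((χ + s * Complex.I) / χ) =
          Complex.log (χ + s * Complex.I) - Complex.log χ := by
        rw [div_eq_mul_inv, Complex.log_mul hne (inv_ne_zero hχ0), Complex.log_inv]
        · ring
        · linarith
        · rw [Complex.arg_inv, if_neg (by linarith)]
          constructor <;> linarith
      rw [Complex.cpow_def_of_ne_zero (div_ne_zero hne hχ0), Complex.cpow_def_of_ne_zero hne,
        Complex.cpow_def_of_ne_zero hχ0, h3, sub_mul, Complex.exp_sub]
    rw [hq]
    simp only
    rw [h1, h2, Complex.cpow_neg χ, div_inv_eq_mul]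
    ring
  have hqint : Integrable q := by
    have h1 : Integrable (fun s : ℝ =>
        Complex.exp (s * Complex.I) * (χ + s * Complex.I) ^ (-α)) := by
      have h2 := integrable_cpow_vertical hχ hα one_pos
      simp only [one_mul] at h2
      refine h2.bdd_mul (c := 1) (Continuous.aestronglyMeasurable (by fun_prop))
        (Eventually.of_forall fun s => ?_)
      rw [Complex.norm_exp_ofReal_mul_I]
    rw [show q = _ from funext hq2]
    exact h1.const_mul _
  have hI1 : hankelRay χ α Complex.I = Complex.I * ∫ s in Iic (0 : ℝ), q s := by
    have h1 := integral_comp_neg_Ioi (0 : ℝ) q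
    rw [neg_zero] at h1
    rw [hankelRay, integral_mul_const, mul_comm, ← h1]
    congr 2
    ext s
    rw [hq]
    simp only
    push_cast
    congr 2 <;> ring
  have hI2 : hankelRay χ α (-Complex.I) = -Complex.I * ∫ s in Ioi (0 : ℝ), q s := by
    rw [hankelRay, integral_mul_const, mul_comm]
    congr 2
    ext s
    rw [hq]
    simp only
    congr 2 <;> ring
  rw [hI1, hI2, neg_mul, sub_neg_eq_add, ← mul_add,
    intervalIntegral.integral_Iic_add_Ioi hqint.integrableOn hqint.integrableOn,
    show q = fun s : ℝ => χ ^ α * (Complex.exp (s * Complex.I) * (χ + s * Complex.I) ^ (-α)) from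
      funext hq2, integral_const_mul, integral_exp_mul_cpow_vertical hχ hα]
  ring

/-! ### The jump for singularities of large order -/

/-- Exponential growth along rays, uniform for directions in a compact set that avoids the singular
direction `φ`. -/
def SectorialGrowth (f : ℂ → ℂ) (δ φ : ℝ) : Prop :=
  ∀ K : Set ℝ, IsCompact K → (∀ β ∈ K, |β| < δ ∧ β ≠ φ) →
    ∃ C B : ℝ, 0 ≤ C ∧ 0 ≤ B ∧ ∀ β ∈ K, ∀ t : ℝ, 0 < t → ‖f (rayPoint β t)‖ ≤ C * Real.exp (B * t)

/-- The Laplace integral `∫ exp (-w / ε) f w dw` along the ray of direction `θ`. -/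
noncomputable def laplaceRay (f : ℂ → ℂ) (θ ε : ℝ) : ℂ :=
  ∫ t in Ioi (0 : ℝ), Complex.exp (-(rayPoint θ t) / (ε : ℂ)) * f (rayPoint θ t) *
    Complex.exp (θ * Complex.I)

theorem norm_exp_neg_div (w : ℂ) (ε : ℝ) :
    ‖Complex.exp (-w / (ε : ℂ))‖ = Real.exp (-w.re / ε) := by
  rw [Complex.norm_exp, Complex.div_ofReal_re, Complex.neg_re]

theorem ofReal_mul_cpow {r : ℝ} (hr : 0 < r) {u : ℂ} (hu : u ≠ 0) (β : ℂ) :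
    ((r : ℂ) * u) ^ β = (r : ℂ) ^ β * u ^ β := by
  have hr' : (r : ℂ) ≠ 0 := Complex.ofReal_ne_zero.2 hr.ne'
  rw [Complex.cpow_def_of_ne_zero (mul_ne_zero hr' hu), Complex.cpow_def_of_ne_zero hr',
    Complex.cpow_def_of_ne_zero hu, Complex.log_ofReal_mul hr hu, Complex.ofReal_log hr.le,
    add_mul, Complex.exp_add]

theorem abs_sin_le_norm_one_sub (x ψ : ℝ) :
    |Real.sin ψ| ≤ ‖1 - x * Complex.exp (ψ * Complex.I)‖ := by
  have h1 : ‖1 - x * Complex.exp (ψ * Complex.I)‖ =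
      ‖Complex.exp ((-ψ : ℝ) * Complex.I) - x‖ := by
    have h2 : (1 - x * Complex.exp (ψ * Complex.I)) * Complex.exp ((-ψ : ℝ) * Complex.I) =
        Complex.exp ((-ψ : ℝ) * Complex.I) - x := by
      rw [sub_mul, one_mul, mul_assoc, ← Complex.exp_add]
      simp
    rw [← h2, norm_mul, Complex.norm_exp_ofReal_mul_I, mul_one]
  rw [h1]
  refine le_trans (le_of_eq ?_) (Complex.abs_im_le_norm _)
  rw [Complex.sub_im, Complex.exp_ofReal_mul_I_im, Complex.ofReal_im, Real.sin_neg, sub_zero,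
    abs_neg]

theorem tendsto_const_div_nhdsGT_zero {c : ℝ} (hc : 0 < c) :
    Tendsto (fun ε : ℝ => c / ε) (𝓝[>] 0) atTop := by
  simpa [div_eq_mul_inv] using tendsto_inv_nhdsGT_zero.const_mul_atTop hc

theorem tendsto_const_mul_exp_neg_mul_one_add (C : ℝ) :
    Tendsto (fun s : ℝ => (C * Real.exp (-s)) * (1 + s)) atTop (𝓝 0) := by
  have h := ((Real.tendsto_pow_mul_exp_neg_atTop_nhds_zero 0).add
    (Real.tendsto_pow_mul_exp_neg_atTop_nhds_zero 1)).const_mul C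
  rw [add_zero, mul_zero] at h
  refine h.congr fun s => ?_
  ring

/-- Position of a translate of the ray of direction `θ` whose vertex lies between `0` and `χ`. -/
theorem exists_polar_translate {δ : ℝ} (hδ : δ ≤ Real.pi / 2) {χ : ℂ} (hχ : χ ∈ openSector δ)
    {θ : ℝ} (hθ : |θ| < δ) {a b : ℝ} (ha : 0 ≤ a) (hb : 0 < b) :
    ∃ β ∈ uIcc χ.arg θ, ∃ r : ℝ, 0 < r ∧ r ≤ a * ‖χ‖ + b ∧
      (a : ℂ) * χ + b * Complex.exp (θ * Complex.I) = rayPoint β r ∧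
      r * Real.sin (β - χ.arg) = b * Real.sin (θ - χ.arg) := by
  have e1 : (a : ℂ) * χ = rayPoint χ.arg (a * ‖χ‖) := by
    rw [rayPoint, Complex.ofReal_mul, mul_assoc, Complex.norm_mul_exp_arg_mul_I]
  have hpos : 0 < a * ‖χ‖ + b := by positivity
  obtain ⟨β, hβ, h1, h2⟩ := exists_polar_of_combination (hχ.2.trans_le hδ) (hθ.trans_le hδ)
    (a := a * ‖χ‖) (b := b) (by positivity) hb.le hpos
  have e2 : (a : ℂ) * χ + b * Complex.exp (θ * Complex.I) =
      rayPoint χ.arg (a * ‖χ‖) + rayPoint θ b := by rw [e1, rayPoint, rayPoint]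
  refine ⟨β, hβ, _, ?_, ?_, e2.trans h1, h2⟩
  · rw [norm_pos_iff]
    intro h
    have hre := congrArg Complex.re h
    have c1 := Real.cos_pos_of_mem_Ioo (x := χ.arg) (abs_lt.1 (hχ.2.trans_le hδ))
    have c2 := Real.cos_pos_of_mem_Ioo (x := θ) (abs_lt.1 (hθ.trans_le hδ))
    rw [Complex.add_re, re_rayPoint, re_rayPoint, Complex.zero_re] at hre
    have : 0 ≤ a * ‖χ‖ * Real.cos χ.arg := by positivity
    have : 0 < b * Real.cos θ := by positivity
    linarith
  · refine (norm_add_le _ _).trans (le_of_eq ?_)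
    rw [norm_rayPoint _ (by positivity), norm_rayPoint _ hb.le]

theorem sin_sub_ne_zero {δ : ℝ} (hδ : δ ≤ Real.pi / 2) {φ θ : ℝ} (hφ : |φ| < δ) (hθ : |θ| < δ)
    (hne : θ ≠ φ) : Real.sin (θ - φ) ≠ 0 := by
  rw [abs_lt] at hφ hθ
  rw [Ne, Real.sin_eq_zero_iff_of_lt_of_lt (by linarith) (by linarith), sub_eq_zero]
  exact hne

theorem abs_lt_of_mem_uIcc {δ φ θ β : ℝ} (hφ : |φ| < δ) (hθ : |θ| < δ) (hβ : β ∈ uIcc φ θ) :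
    |β| < δ := by
  rw [abs_lt] at *
  rcases mem_uIcc.1 hβ with h | h <;> constructor <;> linarith

theorem translate_mem_borelDomain {δ : ℝ} (hδ : δ ≤ Real.pi / 2) {χ : ℂ} (hχ : χ ∈ openSector δ)
    {θ : ℝ} (hθ : |θ| < δ) (hne : θ ≠ χ.arg) {a b : ℝ} (ha : 0 ≤ a) (hb : 0 < b) :
    (a : ℂ) * χ + b * Complex.exp (θ * Complex.I) ∈ borelDomain δ χ := by
  obtain ⟨β, hβ, r, hr, -, h1, h2⟩ := exists_polar_translate hδ hχ hθ ha hb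
  rw [h1]
  refine rayPoint_mem_borelDomain hδ (abs_lt_of_mem_uIcc hχ.2 hθ hβ) ?_ hr
  rintro rfl
  rw [sub_self, Real.sin_zero, mul_zero] at h2
  exact (mul_ne_zero hb.ne' (sin_sub_ne_zero hδ hχ.2 hθ hne)) h2.symm

/-- For a vertex `a χ` with `a < 1` the translated ray may include its vertex, `b = 0`. -/
theorem translate_mem_borelDomain' {δ : ℝ} (hδ : δ ≤ Real.pi / 2) {χ : ℂ} (hχ : χ ∈ openSector δ)
    {θ : ℝ} (hθ : |θ| < δ) (hne : θ ≠ χ.arg) {a b : ℝ} (ha : 0 ≤ a) (ha1 : a < 1) (hb : 0 ≤ b) :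
    (a : ℂ) * χ + b * Complex.exp (θ * Complex.I) ∈ borelDomain δ χ := by
  rcases hb.eq_or_lt with rfl | hb
  · refine ball_subset_borelDomain hχ ?_
    have := norm_pos_iff.2 hχ.1
    rw [mem_ball_zero_iff, Complex.ofReal_zero, zero_mul, add_zero, norm_mul, Complex.norm_real,
      Real.norm_of_nonneg ha]
    nlinarith
  · exact translate_mem_borelDomain hδ hχ hθ hne ha hb

/-- Growth on the translates of the ray of direction `θ` with vertex `a χ`, `0 ≤ a ≤ 1`, outside a
neighbourhood of the vertex. The bound is uniform up to the vertex `χ` itself: at distance at least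
`ρ` from the vertex, the directions of the points stay away from the singular one. -/
theorem SectorialGrowth.translate {f : ℂ → ℂ} {δ : ℝ} (hδ : δ ≤ Real.pi / 2) {χ : ℂ}
    (hχ : χ ∈ openSector δ) (hg : SectorialGrowth f δ χ.arg) {θ : ℝ} (hθ : |θ| < δ)
    (hne : θ ≠ χ.arg) {ρ : ℝ} (hρ : 0 < ρ) :
    ∃ C B : ℝ, 0 ≤ C ∧ 0 ≤ B ∧ ∀ a : ℝ, 0 ≤ a → a ≤ 1 → ∀ b : ℝ, ρ ≤ b →
      ‖f ((a : ℂ) * χ + b * Complex.exp (θ * Complex.I))‖ ≤ C * Real.exp (B * b) := by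
  have hs := abs_pos.2 (sin_sub_ne_zero hδ hχ.2 hθ hne)
  set q := |Real.sin (θ - χ.arg)| with hq
  have hn := norm_pos_iff.2 hχ.1
  -- far from the vertex, the translated ray stays away from the singular direction
  set m := ρ * q / (‖χ‖ + ρ) with hm
  have hm0 : 0 < m := by positivity
  obtain ⟨C, B, hC, hB, hCB⟩ := hg (uIcc χ.arg θ ∩ {β | m ≤ |β - χ.arg|})
    (isCompact_uIcc.inter_right (isClosed_le continuous_const (by fun_prop))) (by
      rintro β ⟨h1, h2⟩
      refine ⟨abs_lt_of_mem_uIcc hχ.2 hθ h1, ?_⟩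
      rintro rfl
      rw [mem_ofPred_eq, sub_self, abs_zero] at h2
      linarith)
  refine ⟨C * Real.exp (B * ‖χ‖), B, by positivity, hB, fun a ha ha1 b hb => ?_⟩
  have hb0 : 0 < b := hρ.trans_le hb
  obtain ⟨β, hβ, r, hr, hrle, h1, h2⟩ := exists_polar_translate hδ hχ hθ ha hb0
  have hr2 : r ≤ ‖χ‖ + b := hrle.trans (by nlinarith)
  have hmem : m ≤ |β - χ.arg| := by
    have h3 : r * |Real.sin (β - χ.arg)| = b * q := by
      have := congrArg abs h2
      rwa [abs_mul, abs_mul, abs_of_pos hr, abs_of_pos hb0] at this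
    have h4 : |Real.sin (β - χ.arg)| ≤ |β - χ.arg| := Real.abs_sin_le_abs
    refine le_trans ?_ h4
    have h5 : b * q ≤ (‖χ‖ + b) * |Real.sin (β - χ.arg)| := by
      rw [← h3]; gcongr
    have h6 : m ≤ b * q / (‖χ‖ + b) := by
      rw [hm, div_le_div_iff₀ (by positivity) (by positivity)]
      nlinarith [mul_le_mul_of_nonneg_left hb (mul_pos hs hn).le]
    refine h6.trans ?_
    rw [div_le_iff₀ (by positivity)]
    linarith
  rw [h1]
  refine (hCB β ⟨hβ, hmem⟩ r hr).trans ?_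
  rw [mul_assoc, ← Real.exp_add, ← mul_add]
  gcongr

theorem continuousOn_translate {f : ℂ → ℂ} {δ : ℝ} (hδ : δ ≤ Real.pi / 2) {χ : ℂ}
    (hχ : χ ∈ openSector δ) (hf : DifferentiableOn ℂ f (borelDomain δ χ)) {θ : ℝ} (hθ : |θ| < δ)
    (hne : θ ≠ χ.arg) {a k : ℝ} (ha : 0 ≤ a) (hk : 0 < k) :
    ContinuousOn (fun s : ℝ => f ((a : ℂ) * χ + (k * s : ℝ) * Complex.exp (θ * Complex.I)))
      (Ioi 0) := by
  refine hf.continuousOn.comp (by fun_prop) fun s hs => ?_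
  exact translate_mem_borelDomain hδ hχ hθ hne ha (mul_pos hk hs)

/-- `f` has the singular expansion `(1 - w / χ) ^ (-α) * h w + g w` near `χ`. -/
structure HasSingularExpansion (f : ℂ → ℂ) (χ α : ℂ) (h g : ℂ → ℂ) : Prop where
  analyticAt_amplitude : AnalyticAt ℂ h χ
  analyticAt_regular : AnalyticAt ℂ g χ
  eventually_eq : ∀ᶠ w in 𝓝 χ, w ∉ singularCut χ → f w = (1 - w / χ) ^ (-α) * h w + g w

theorem one_sub_vertex_div {χ : ℂ} (hχ : χ ≠ 0) (ε s θ : ℝ) :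
    1 - (((1 - ε : ℝ) : ℂ) * χ + (ε * s : ℝ) * Complex.exp (θ * Complex.I)) / χ =
      ε * (1 - s * Complex.exp (θ * Complex.I) / χ) := by
  push_cast
  field_simp
  ring

theorem abs_sin_le_norm_one_sub_div {χ : ℂ} (hχ : χ ≠ 0) (θ s : ℝ) :
    |Real.sin (θ - χ.arg)| ≤ ‖1 - s * Complex.exp (θ * Complex.I) / χ‖ := by
  have h := abs_sin_le_norm_one_sub (s / ‖χ‖) (θ - χ.arg)
  have hn : (‖χ‖ : ℂ) ≠ 0 := Complex.ofReal_ne_zero.2 (norm_ne_zero_iff.2 hχ)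
  have e : ((s / ‖χ‖ : ℝ) : ℂ) * Complex.exp ((θ - χ.arg : ℝ) * Complex.I) =
      s * Complex.exp (θ * Complex.I) / χ := by
    conv_rhs => rw [← Complex.norm_mul_exp_arg_mul_I χ]
    push_cast
    rw [sub_mul, Complex.exp_sub]
    field_simp
  rwa [e] at h

/-- Uniform bound for `f` on the contour with vertex `(1 - ε) χ`, at the scale `ε`. -/
theorem HasSingularExpansion.norm_le {f h g : ℂ → ℂ} {δ : ℝ} (hδ : δ ≤ Real.pi / 2) {χ α : ℂ}
    (hχ : χ ∈ openSector δ) (hg : SectorialGrowth f δ χ.arg)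
    (hs : HasSingularExpansion f χ α h g) (hα : 0 < α.re) {θ : ℝ} (hθ : |θ| < δ)
    (hne : θ ≠ χ.arg) :
    ∃ C B : ℝ, 0 ≤ C ∧ 0 ≤ B ∧ ∀ᶠ ε : ℝ in 𝓝[>] 0, ∀ s : ℝ, 0 < s →
      ‖f (((1 - ε : ℝ) : ℂ) * χ + (ε * s : ℝ) * Complex.exp (θ * Complex.I))‖ ≤
        C * ε ^ (-α.re) * Real.exp (B * (ε * s)) := by
  have hn := norm_pos_iff.2 hχ.1
  have hq := abs_pos.2 (sin_sub_ne_zero hδ hχ.2 hθ hne)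
  set q := |Real.sin (θ - χ.arg)| with hqdef
  set E := Real.exp (Real.pi * |α.im|) with hE
  have hh := hs.analyticAt_amplitude.continuousAt.norm.eventually_lt_const
    (lt_add_one ‖h χ‖)
  have hgg := hs.analyticAt_regular.continuousAt.norm.eventually_lt_const (lt_add_one ‖g χ‖)
  have hsmall : ∀ᶠ w in 𝓝 χ, ‖1 - w / χ‖ < 1 := by
    have hc : ContinuousAt (fun w : ℂ => ‖1 - w / χ‖) χ := by fun_prop
    exact hc.eventually_lt_const (by simp [hχ.1])
  obtain ⟨ρ, hρ, hball⟩ := Metric.eventually_nhds_iff_ball.1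
    (((hs.eventually_eq.and hh).and hgg).and hsmall)
  obtain ⟨C, B, hC, hB, hfar⟩ := hg.translate hδ hχ hθ hne (half_pos hρ)
  set M := E * (‖h χ‖ + 1) + (‖g χ‖ + 1) with hM
  have hM0 : 0 ≤ M := by positivity
  refine ⟨M * q ^ (-α.re) + C, B, by positivity, hB, ?_⟩
  filter_upwards [self_mem_nhdsWithin,
    mem_nhdsWithin_of_mem_nhds (Iio_mem_nhds (zero_lt_one' ℝ)),
    mem_nhdsWithin_of_mem_nhds (Iio_mem_nhds (show 0 < ρ / 2 / ‖χ‖ by positivity))]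
    with ε hε hε1 hε2 s hs0
  rw [mem_Ioi] at hε
  rw [mem_Iio] at hε1 hε2
  rw [lt_div_iff₀ hn] at hε2
  have hεs : 0 < ε * s := mul_pos hε hs0
  set w := ((1 - ε : ℝ) : ℂ) * χ + (ε * s : ℝ) * Complex.exp (θ * Complex.I) with hw
  have hpow : 1 ≤ ε ^ (-α.re) := Real.one_le_rpow_of_pos_of_le_one_of_nonpos hε hε1.le (by linarith)
  have hexp : 1 ≤ Real.exp (B * (ε * s)) := Real.one_le_exp (by positivity)
  by_cases hwρ : w ∈ Metric.ball χ ρ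
  · obtain ⟨⟨⟨h1, h2⟩, h3⟩, h4⟩ := hball w hwρ
    have hcut : w ∉ singularCut χ :=
      (translate_mem_borelDomain hδ hχ hθ hne (sub_nonneg.2 hε1.le) hεs).2
    have e1 : 1 - w / χ = ε * (1 - s * Complex.exp (θ * Complex.I) / χ) :=
      one_sub_vertex_div hχ.1 ε s θ
    have hu : ε * q ≤ ‖1 - w / χ‖ := by
      rw [e1, norm_mul, Complex.norm_real, Real.norm_of_nonneg hε.le]
      gcongr
      exact abs_sin_le_norm_one_sub_div hχ.1 θ s
    have hεq : 0 < ε * q := by positivity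
    have hu0 := hεq.trans_le hu
    have hone : 1 ≤ ‖1 - w / χ‖ ^ (-α.re) :=
      Real.one_le_rpow_of_pos_of_le_one_of_nonpos hu0 h4.le (by linarith)
    have hle : ‖f w‖ ≤ M * ‖1 - w / χ‖ ^ (-α.re) := by
      rw [h1 hcut]
      calc ‖(1 - w / χ) ^ (-α) * h w + g w‖
          ≤ ‖(1 - w / χ) ^ (-α)‖ * ‖h w‖ + ‖g w‖ := by
            refine (norm_add_le _ _).trans ?_
            rw [norm_mul]
        _ ≤ (E * ‖1 - w / χ‖ ^ (-α.re)) * (‖h χ‖ + 1) + (‖g χ‖ + 1) * 1 := by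
            rw [mul_one]
            gcongr
            exact norm_cpow_neg_le (norm_pos_iff.1 hu0) α
        _ ≤ (E * ‖1 - w / χ‖ ^ (-α.re)) * (‖h χ‖ + 1) + (‖g χ‖ + 1) * ‖1 - w / χ‖ ^ (-α.re) := by
            gcongr
        _ = M * ‖1 - w / χ‖ ^ (-α.re) := by rw [hM]; ring
    have hle2 : ‖1 - w / χ‖ ^ (-α.re) ≤ q ^ (-α.re) * ε ^ (-α.re) := by
      rw [← Real.mul_rpow hq.le hε.le, mul_comm q]
      exact Real.rpow_le_rpow_of_nonpos hεq hu (by linarith)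
    calc ‖f w‖ ≤ M * (q ^ (-α.re) * ε ^ (-α.re)) := hle.trans (by gcongr)
      _ = (M * q ^ (-α.re)) * ε ^ (-α.re) * 1 := by ring
      _ ≤ (M * q ^ (-α.re) + C) * ε ^ (-α.re) * Real.exp (B * (ε * s)) := by
          gcongr
          linarith
  · have hb : ρ / 2 ≤ ε * s := by
      by_contra hcon
      push Not at hcon
      refine hwρ ?_
      rw [mem_ball_iff_norm]
      have e2 : w - χ = -((ε : ℂ) * χ) + (ε * s : ℝ) * Complex.exp (θ * Complex.I) := by
        rw [hw]; push_cast; ring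
      rw [e2]
      refine (norm_add_le _ _).trans_lt ?_
      rw [norm_neg, norm_mul, norm_mul, Complex.norm_exp_ofReal_mul_I, Complex.norm_real,
        Complex.norm_real, Real.norm_of_nonneg hε.le, Real.norm_of_nonneg hεs.le, mul_one]
      linarith
    calc ‖f w‖ ≤ C * Real.exp (B * (ε * s)) :=
          hfar _ (sub_nonneg.2 hε1.le) (by linarith) _ hb
      _ = C * 1 * Real.exp (B * (ε * s)) := by ring
      _ ≤ (M * q ^ (-α.re) + C) * ε ^ (-α.re) * Real.exp (B * (ε * s)) := by
          gcongr
          have : 0 ≤ M * q ^ (-α.re) := by positivity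
          linarith

/-- The Laplace integral along the ray of direction `θ` with vertex `(1 - ε) χ`. -/
noncomputable def vertexRay (f : ℂ → ℂ) (χ : ℂ) (θ ε : ℝ) : ℂ :=
  ∫ s in Ioi (0 : ℝ),
    Complex.exp (-(((1 - ε : ℝ) : ℂ) * χ + s * Complex.exp (θ * Complex.I)) / (ε : ℂ)) *
      f (((1 - ε : ℝ) : ℂ) * χ + s * Complex.exp (θ * Complex.I)) * Complex.exp (θ * Complex.I)

/-- Rescaling by `ε` around `χ`. -/
theorem vertexRay_eq (f : ℂ → ℂ) (χ : ℂ) (θ : ℝ) {ε : ℝ} (hε : 0 < ε) :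
    vertexRay f χ θ ε = ε * Complex.exp (-χ / ε) * Complex.exp χ *
      ∫ s in Ioi (0 : ℝ), Complex.exp (-(s * Complex.exp (θ * Complex.I))) *
        f (((1 - ε : ℝ) : ℂ) * χ + (ε * s : ℝ) * Complex.exp (θ * Complex.I)) *
        Complex.exp (θ * Complex.I) := by
  have hε' : (ε : ℂ) ≠ 0 := Complex.ofReal_ne_zero.2 hε.ne'
  have h := integral_comp_mul_left_Ioi (fun s : ℝ =>
    Complex.exp (-(((1 - ε : ℝ) : ℂ) * χ + s * Complex.exp (θ * Complex.I)) / (ε : ℂ)) *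
      f (((1 - ε : ℝ) : ℂ) * χ + s * Complex.exp (θ * Complex.I)) * Complex.exp (θ * Complex.I))
    0 hε
  rw [mul_zero] at h
  have h2 : vertexRay f χ θ ε = ε * ((ε⁻¹ : ℝ) • vertexRay f χ θ ε) := by
    rw [Complex.real_smul, Complex.ofReal_inv, mul_inv_cancel_left₀ hε']
  rw [h2, vertexRay, ← h, mul_assoc, mul_assoc]
  congr 1
  rw [← mul_assoc, ← integral_const_mul]
  congr 1
  ext s
  rw [← Complex.exp_add, ← mul_assoc, ← mul_assoc, ← Complex.exp_add]
  congr 3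
  push_cast
  field_simp
  ring

theorem aestronglyMeasurable_vertex {f : ℂ → ℂ} {δ : ℝ} (hδ : δ ≤ Real.pi / 2) {χ : ℂ}
    (hχ : χ ∈ openSector δ) (hf : DifferentiableOn ℂ f (borelDomain δ χ)) {θ : ℝ} (hθ : |θ| < δ)
    (hne : θ ≠ χ.arg) {ε : ℝ} (hε : 0 < ε) (hε1 : ε < 1) :
    AEStronglyMeasurable (fun s : ℝ => Complex.exp (-(s * Complex.exp (θ * Complex.I))) *
        f (((1 - ε : ℝ) : ℂ) * χ + (ε * s : ℝ) * Complex.exp (θ * Complex.I)) *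
        Complex.exp (θ * Complex.I)) (volume.restrict (Ioi 0)) := by
  refine ContinuousOn.aestronglyMeasurable ?_ measurableSet_Ioi
  refine ContinuousOn.mul (ContinuousOn.mul (by fun_prop) ?_) continuousOn_const
  exact continuousOn_translate hδ hχ hf hθ hne (sub_nonneg.2 hε1.le) hε

/-- The dominating function of the rescaled contour: for small `ε` half of the exponential decay
absorbs the growth of `f`. -/
theorem HasSingularExpansion.norm_vertex_le {f h g : ℂ → ℂ} {δ : ℝ} (hδ : δ ≤ Real.pi / 2)
    {χ α : ℂ} (hχ : χ ∈ openSector δ) (hg : SectorialGrowth f δ χ.arg)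
    (hs : HasSingularExpansion f χ α h g) (hα : 0 < α.re) {θ : ℝ} (hθ : |θ| < δ)
    (hne : θ ≠ χ.arg) :
    ∃ C : ℝ, ∀ᶠ ε : ℝ in 𝓝[>] 0, ∀ s : ℝ, 0 < s →
      ‖Complex.exp (-(s * Complex.exp (θ * Complex.I))) *
        f (((1 - ε : ℝ) : ℂ) * χ + (ε * s : ℝ) * Complex.exp (θ * Complex.I)) *
        Complex.exp (θ * Complex.I)‖ ≤
        C * ε ^ (-α.re) * Real.exp (-(Real.cos θ / 2) * s) := by
  obtain ⟨C, B, hC, hB, hCB⟩ := hs.norm_le hδ hχ hg hα hθ hne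
  have hcos := Real.cos_pos_of_mem_Ioo (x := θ) (abs_lt.1 (hθ.trans_le hδ))
  refine ⟨C, ?_⟩
  filter_upwards [hCB, self_mem_nhdsWithin, mem_nhdsWithin_of_mem_nhds
    (Iio_mem_nhds (show 0 < Real.cos θ / 2 / (B + 1) by positivity))] with ε h1 hε h2 s hs0
  rw [mem_Ioi] at hε
  rw [mem_Iio, lt_div_iff₀ (by positivity)] at h2
  rw [norm_mul, norm_mul, Complex.norm_exp_ofReal_mul_I, mul_one, Complex.norm_exp,
    Complex.neg_re, Complex.re_ofReal_mul, Complex.exp_ofReal_mul_I_re]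
  calc Real.exp (-(s * Real.cos θ)) *
        ‖f (((1 - ε : ℝ) : ℂ) * χ + (ε * s : ℝ) * Complex.exp (θ * Complex.I))‖
      ≤ Real.exp (-(s * Real.cos θ)) * (C * ε ^ (-α.re) * Real.exp (B * (ε * s))) := by
        gcongr
        exact h1 s hs0
    _ = C * ε ^ (-α.re) * Real.exp (-(s * Real.cos θ) + B * (ε * s)) := by
        rw [Real.exp_add]; ring
    _ ≤ C * ε ^ (-α.re) * Real.exp (-(Real.cos θ / 2) * s) := by
        have : 0 ≤ ε ^ (-α.re) := by positivity
        gcongr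
        nlinarith

/-- Contribution of one arm of the contour around the singularity: at the scale `ε` it converges
to an arm of the Hankel contour. -/
theorem HasSingularExpansion.tendsto_vertexRay {f h g : ℂ → ℂ} {δ : ℝ} (hδ : δ ≤ Real.pi / 2)
    {χ α : ℂ} (hχ : χ ∈ openSector δ) (hf : DifferentiableOn ℂ f (borelDomain δ χ))
    (hg : SectorialGrowth f δ χ.arg)
    (hs : HasSingularExpansion f χ α h g) (hα : 0 < α.re) {θ : ℝ} (hθ : |θ| < δ)
    (hne : θ ≠ χ.arg) :
    Tendsto (fun ε : ℝ => (ε : ℂ) ^ (α - 1) * Complex.exp (χ / ε) * vertexRay f χ θ ε) (𝓝[>] 0)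
      (𝓝 (Complex.exp χ * (h χ * hankelRay χ α (Complex.exp (θ * Complex.I))))) := by
  obtain ⟨C, hC⟩ := hs.norm_vertex_le hδ hχ hg hα hθ hne
  have hcos := Real.cos_pos_of_mem_Ioo (x := θ) (abs_lt.1 (hθ.trans_le hδ))
  set d := Complex.exp (θ * Complex.I) with hd
  have hlt1 : ∀ᶠ ε : ℝ in 𝓝[>] 0, ε < 1 :=
    mem_nhdsWithin_of_mem_nhds (Iio_mem_nhds (zero_lt_one' ℝ))
  have hcpow0 : Tendsto (fun ε : ℝ => (ε : ℂ) ^ α) (𝓝[>] 0) (𝓝 0) := by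
    rw [tendsto_zero_iff_norm_tendsto_zero]
    have h1 : Tendsto (fun ε : ℝ => ε ^ α.re) (𝓝[>] 0) (𝓝 0) := by
      have := (Real.continuousAt_rpow_const 0 α.re (Or.inr hα.le)).tendsto
      rw [Real.zero_rpow hα.ne'] at this
      exact this.mono_left nhdsWithin_le_nhds
    refine h1.congr' ?_
    filter_upwards [self_mem_nhdsWithin] with ε hε
    rw [Complex.norm_cpow_eq_rpow_re_of_pos hε]
  have key : Tendsto (fun ε : ℝ => ∫ s in Ioi (0 : ℝ), (ε : ℂ) ^ α *
      (Complex.exp (-(s * d)) * f (((1 - ε : ℝ) : ℂ) * χ + (ε * s : ℝ) * d) * d)) (𝓝[>] 0)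
      (𝓝 (∫ s in Ioi (0 : ℝ), h χ * (Complex.exp (-(s * d)) * (1 - s * d / χ) ^ (-α) * d))) := by
    refine tendsto_integral_filter_of_dominated_convergence
      (fun s => C * Real.exp (-(Real.cos θ / 2) * s)) ?_ ?_ ?_ ?_
    · filter_upwards [self_mem_nhdsWithin, hlt1] with ε hε hε1
      exact (aestronglyMeasurable_vertex hδ hχ hf hθ hne hε hε1).const_mul _
    · filter_upwards [hC, self_mem_nhdsWithin] with ε h1 hε
      filter_upwards [ae_restrict_mem measurableSet_Ioi] with s hs0
      rw [mem_Ioi] at hε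
      rw [norm_mul, Complex.norm_cpow_eq_rpow_re_of_pos hε]
      refine (mul_le_mul_of_nonneg_left (h1 s hs0) (by positivity)).trans (le_of_eq ?_)
      rw [mul_assoc C, mul_left_comm, ← mul_assoc (ε ^ α.re), ← Real.rpow_add hε, add_neg_cancel,
        Real.rpow_zero, one_mul]
    · exact (exp_neg_integrableOn_Ioi 0 (half_pos hcos)).const_mul _
    · filter_upwards [ae_restrict_mem measurableSet_Ioi] with s hs0
      have hs0' : 0 < s := hs0
      have hw : Tendsto (fun ε : ℝ => ((1 - ε : ℝ) : ℂ) * χ + (ε * s : ℝ) * d) (𝓝[>] 0) (𝓝 χ) := by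
        have hc : Continuous (fun ε : ℝ => ((1 - ε : ℝ) : ℂ) * χ + (ε * s : ℝ) * d) := by
          fun_prop
        exact (hc.tendsto' 0 χ (by simp)).mono_left nhdsWithin_le_nhds
      have hne0 : 1 - s * d / χ ≠ 0 := by
        have h1 := abs_pos.2 (sin_sub_ne_zero hδ hχ.2 hθ hne)
        exact norm_pos_iff.1 (h1.trans_le (abs_sin_le_norm_one_sub_div hχ.1 θ s))
      have hlim : Tendsto (fun ε : ℝ => Complex.exp (-(s * d)) * d *
          ((1 - s * d / χ) ^ (-α) * h (((1 - ε : ℝ) : ℂ) * χ + (ε * s : ℝ) * d) +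
            (ε : ℂ) ^ α * g (((1 - ε : ℝ) : ℂ) * χ + (ε * s : ℝ) * d))) (𝓝[>] 0)
          (𝓝 (Complex.exp (-(s * d)) * d * ((1 - s * d / χ) ^ (-α) * h χ + 0 * g χ))) := by
        refine Tendsto.const_mul _ (Tendsto.add (Tendsto.const_mul _ ?_) (hcpow0.mul ?_))
        · exact hs.analyticAt_amplitude.continuousAt.tendsto.comp hw
        · exact hs.analyticAt_regular.continuousAt.tendsto.comp hw
      have e1 : Complex.exp (-(s * d)) * d * ((1 - s * d / χ) ^ (-α) * h χ + 0 * g χ) =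
          h χ * (Complex.exp (-(s * d)) * (1 - s * d / χ) ^ (-α) * d) := by ring
      rw [e1] at hlim
      refine hlim.congr' ?_
      filter_upwards [hw.eventually hs.eventually_eq, self_mem_nhdsWithin, hlt1] with ε h1 hε hε1
      rw [mem_Ioi] at hε
      have hcut := (translate_mem_borelDomain hδ hχ hθ hne (sub_nonneg.2 hε1.le)
        (mul_pos hε hs0')).2
      rw [h1 hcut, hd, one_sub_vertex_div hχ.1, ofReal_mul_cpow hε hne0, Complex.cpow_neg (ε : ℂ)]
      have hεα : (ε : ℂ) ^ α ≠ 0 := by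
        rw [Complex.cpow_ne_zero_iff]
        exact Or.inl (Complex.ofReal_ne_zero.2 hε.ne')
      rw [← hd]
      field_simp
  have h2 := key.const_mul (Complex.exp χ)
  rw [integral_const_mul] at h2
  refine h2.congr' ?_
  filter_upwards [self_mem_nhdsWithin] with ε hε
  have hε' : (ε : ℂ) ≠ 0 := Complex.ofReal_ne_zero.2 (ne_of_gt hε)
  rw [integral_const_mul, vertexRay_eq f χ θ hε, ← hd, Complex.cpow_sub _ _ hε', Complex.cpow_one,
    neg_div, Complex.exp_neg]
  have := Complex.exp_ne_zero (χ / ε)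
  generalize (∫ s in Ioi (0 : ℝ), Complex.exp (-(s * d)) *
    f (((1 - ε : ℝ) : ℂ) * χ + (ε * s : ℝ) * d) * d) = X
  field_simp

theorem continuousOn_rayPoint {f : ℂ → ℂ} {δ : ℝ} (hδ : δ ≤ Real.pi / 2) {χ : ℂ}
    (hf : ContinuousOn f (borelDomain δ χ)) {θ : ℝ} (hθ : |θ| < δ)
    (hne : θ ≠ χ.arg) : ContinuousOn (fun t : ℝ => f (rayPoint θ t)) (Ioi 0) := by
  refine hf.comp (by unfold rayPoint; fun_prop) fun s hs => ?_
  exact rayPoint_mem_borelDomain hδ hθ hne hs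

/-- The growth rate `B` of `f` is absorbed by the decay rate `cos θ / ε` of the exponential. -/
theorem norm_laplace_integrand_le {f : ℂ → ℂ} {θ C B ε t c : ℝ}
    (ht : 0 < t) (hf : ‖f (rayPoint θ t)‖ ≤ C * Real.exp (B * t))
    (hc : c ≤ Real.cos θ / ε - B) (hC : 0 ≤ C) :
    ‖Complex.exp (-(rayPoint θ t) / (ε : ℂ)) * f (rayPoint θ t) * Complex.exp (θ * Complex.I)‖ ≤
      C * Real.exp (-c * t) := by
  rw [norm_mul, norm_mul, Complex.norm_exp_ofReal_mul_I, mul_one, norm_exp_neg_div, re_rayPoint]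
  calc Real.exp (-(t * Real.cos θ) / ε) * ‖f (rayPoint θ t)‖
      ≤ Real.exp (-(t * Real.cos θ) / ε) * (C * Real.exp (B * t)) := by gcongr
    _ = C * Real.exp (-(Real.cos θ / ε - B) * t) := by
        rw [mul_left_comm, ← Real.exp_add]
        congr 2
        ring
    _ ≤ C * Real.exp (-c * t) := by gcongr

theorem integrableOn_laplace {f : ℂ → ℂ} {δ : ℝ} (hδ : δ ≤ Real.pi / 2) {χ : ℂ}
    (hf : ContinuousOn f (borelDomain δ χ)) {θ C B ε : ℝ} (hθ : |θ| < δ)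
    (hne : θ ≠ χ.arg) (hC : 0 ≤ C)
    (hg : ∀ t : ℝ, 0 < t → ‖f (rayPoint θ t)‖ ≤ C * Real.exp (B * t))
    (hε : B + 1 ≤ Real.cos θ / ε) :
    IntegrableOn (fun t : ℝ => Complex.exp (-(rayPoint θ t) / (ε : ℂ)) * f (rayPoint θ t) *
      Complex.exp (θ * Complex.I)) (Ioi 0) := by
  refine Integrable.mono' ((exp_neg_integrableOn_Ioi 0 one_pos).const_mul C) ?_ ?_
  · refine ContinuousOn.aestronglyMeasurable ?_ measurableSet_Ioi
    refine ContinuousOn.mul (ContinuousOn.mul ?_ (continuousOn_rayPoint hδ hf hθ hne))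
      continuousOn_const
    unfold rayPoint
    fun_prop
  · filter_upwards [ae_restrict_mem measurableSet_Ioi] with t ht
    exact norm_laplace_integrand_le ht (hg t ht) (by linarith) hC

/-- The vertex of the ray may be moved from `0` to `(1 - ε) χ`. -/
theorem eventually_laplaceRay_eq {f h g : ℂ → ℂ} {δ : ℝ} (hδ : δ ≤ Real.pi / 2)
    {χ α : ℂ} (hχ : χ ∈ openSector δ) (hf : DifferentiableOn ℂ f (borelDomain δ χ))
    (hg : SectorialGrowth f δ χ.arg)
    (hs : HasSingularExpansion f χ α h g) (hα : 0 < α.re) {θ : ℝ} (hθ : |θ| < δ)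
    (hne : θ ≠ χ.arg) :
    ∀ᶠ ε : ℝ in 𝓝[>] 0, ∀ P : ℂ → ℂ,
      (∀ w ∈ borelDomain δ χ, HasDerivAt P (Complex.exp (-w / (ε : ℂ)) * f w) w) →
      P 0 + laplaceRay f θ ε = P (((1 - ε : ℝ) : ℂ) * χ) + vertexRay f χ θ ε := by
  obtain ⟨C₁, hC₁⟩ := hs.norm_vertex_le hδ hχ hg hα hθ hne
  obtain ⟨C₂, B₂, hC₂, hB₂, hfar⟩ := hg.translate hδ hχ hθ hne one_pos
  obtain ⟨C₃, B₃, hC₃, hB₃, hray⟩ := hg {θ} isCompact_singleton (by simpa using ⟨hθ, hne⟩)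
  have hcos := Real.cos_pos_of_mem_Ioo (x := θ) (abs_lt.1 (hθ.trans_le hδ))
  have hdiv := tendsto_const_div_nhdsGT_zero hcos
  have hre : 0 < χ.re := re_pos_of_mem_openSector hδ hχ
  filter_upwards [hC₁, self_mem_nhdsWithin, mem_nhdsWithin_of_mem_nhds
    (Iio_mem_nhds (zero_lt_one' ℝ)), hdiv.eventually_ge_atTop (B₂ + 1),
    hdiv.eventually_ge_atTop (B₃ + 1)] with ε h1 hε hε1 h2 h3 P hP
  rw [mem_Ioi] at hε
  rw [mem_Iio] at hε1
  set d := Complex.exp (θ * Complex.I) with hd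
  have hb := tendsto_const_mul_exp_neg_mul_one_add C₂
  have key := integral_ray_eq_of_primitive (P := P) (G := fun w => Complex.exp (-w / (ε : ℂ)) * f w)
    (v₁ := 0) (d₁ := d) (v₂ := ((1 - ε : ℝ) : ℂ) * χ) (d₂ := d) ?_ ?_ ?_ ?_ hb ?_
  · simp only [zero_add] at key
    exact key
  · intro s hs0
    have := translate_mem_borelDomain' hδ hχ hθ hne le_rfl one_pos hs0
    rw [Complex.ofReal_zero, zero_mul] at this
    exact hP _ this
  · intro s hs0
    exact hP _ (translate_mem_borelDomain' hδ hχ hθ hne (sub_nonneg.2 hε1.le) (by linarith) hs0)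
  · simp only [zero_add]
    exact integrableOn_laplace hδ hf.continuousOn hθ hne hC₃ (hray θ rfl) h3
  · have hI : IntegrableOn (fun s : ℝ => Complex.exp (-(s * d)) *
        f (((1 - ε : ℝ) : ℂ) * χ + (ε * s : ℝ) * d) * d) (Ioi 0) := by
      refine Integrable.mono' ((exp_neg_integrableOn_Ioi 0 (half_pos hcos)).const_mul
        (C₁ * ε ^ (-α.re))) (aestronglyMeasurable_vertex hδ hχ hf hθ hne hε hε1) ?_
      filter_upwards [ae_restrict_mem measurableSet_Ioi] with s hs0
      exact h1 s hs0
    have hI2 := hI.const_mul (Complex.exp (-χ / ε) * Complex.exp χ)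
    have hI3 := (integrableOn_Ioi_comp_mul_left_iff (fun s : ℝ =>
      Complex.exp (-(((1 - ε : ℝ) : ℂ) * χ + s * d) / (ε : ℂ)) *
      f (((1 - ε : ℝ) : ℂ) * χ + s * d) * d) 0 hε).1
    rw [mul_zero] at hI3
    refine hI3 (hI2.congr (Eventually.of_forall fun s => ?_))
    have hε' : (ε : ℂ) ≠ 0 := Complex.ofReal_ne_zero.2 hε.ne'
    simp only
    rw [← Complex.exp_add, ← mul_assoc, ← mul_assoc, ← Complex.exp_add]
    congr 3
    push_cast
    field_simp
    ring
  · filter_upwards [eventually_ge_atTop 1] with s hs1 w hw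
    obtain ⟨a, b, ha, hb, hab, rfl⟩ := hw
    have e1 : a • (0 + (s : ℂ) * d) + b • (((1 - ε : ℝ) : ℂ) * χ + s * d) =
        ((b * (1 - ε) : ℝ) : ℂ) * χ + s * d := by
      have : (a : ℂ) + b = 1 := by exact_mod_cast hab
      simp only [Complex.real_smul]
      push_cast
      linear_combination (s * d) * this
    rw [e1]
    have hb1 : b ≤ 1 := by linarith
    have ha' : 0 ≤ b * (1 - ε) := mul_nonneg hb (by linarith)
    have ha1 : b * (1 - ε) ≤ 1 := by nlinarith
    refine ⟨hP _ (translate_mem_borelDomain hδ hχ hθ hne ha' (by linarith)), ?_⟩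
    rw [norm_mul, norm_exp_neg_div]
    have hwre : (((b * (1 - ε) : ℝ) : ℂ) * χ + s * d).re =
        b * (1 - ε) * χ.re + s * Real.cos θ := by
      rw [Complex.add_re, Complex.re_ofReal_mul, Complex.re_ofReal_mul, hd,
        Complex.exp_ofReal_mul_I_re]
    rw [hwre]
    have hle : -(b * (1 - ε) * χ.re + s * Real.cos θ) / ε ≤ -(Real.cos θ / ε) * s := by
      have : -(Real.cos θ / ε) * s = -(s * Real.cos θ) / ε := by ring
      rw [this]
      gcongr
      have : 0 ≤ b * (1 - ε) * χ.re := by positivity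
      linarith
    calc _ ≤ Real.exp (-(Real.cos θ / ε) * s) * (C₂ * Real.exp (B₂ * s)) := by
          gcongr
          exact hfar _ ha' ha1 s hs1
      _ = C₂ * Real.exp (-(Real.cos θ / ε - B₂) * s) := by
          rw [mul_left_comm, ← Real.exp_add]
          congr 2
          ring
      _ ≤ C₂ * Real.exp (-s) := by
          gcongr
          nlinarith

/-- The jump of the Laplace integral across a singularity of order `Re α > 1`. -/
theorem HasSingularExpansion.tendsto_jump {f h g : ℂ → ℂ} {δ : ℝ} (hδ : δ ≤ Real.pi / 2)
    {χ α : ℂ} (hχ : χ ∈ openSector δ) (hf : DifferentiableOn ℂ f (borelDomain δ χ))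
    (hg : SectorialGrowth f δ χ.arg)
    (hs : HasSingularExpansion f χ α h g) (hα : 1 < α.re) {θ : ℝ} (hθ : θ < δ)
    (hχθ : |χ.arg| < θ) :
    Tendsto (fun ε : ℝ => (ε : ℂ) ^ (α - 1) * Complex.exp (χ / ε) *
      (laplaceRay f θ ε - laplaceRay f (-θ) ε)) (𝓝[>] 0)
      (𝓝 (2 * Real.pi * Complex.I * h χ * χ ^ α / Complex.Gamma α)) := by
  have hθ0 : 0 < θ := (abs_nonneg _).trans_lt hχθ
  have hθ1 : |θ| < δ := by rwa [abs_of_pos hθ0]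
  have hθ2 : |-θ| < δ := by rwa [abs_neg]
  have hne1 : θ ≠ χ.arg := fun h => by rw [← h, abs_of_pos hθ0] at hχθ; exact hχθ.false
  have hne2 : -θ ≠ χ.arg := fun h => by rw [← h, abs_neg, abs_of_pos hθ0] at hχθ; exact hχθ.false
  have hα0 : 0 < α.re := by linarith
  have hre : 0 < χ.re := re_pos_of_mem_openSector hδ hχ
  have h1 := hs.tendsto_vertexRay hδ hχ hf hg hα0 hθ1 hne1
  have h2 := hs.tendsto_vertexRay hδ hχ hf hg hα0 hθ2 hne2
  have h3 := h1.sub h2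
  have hH := hankelRay_sub_hankelRay hre hα hχθ (hθ.trans_le hδ)
  have e1 : Complex.exp χ * (h χ * hankelRay χ α (Complex.exp (θ * Complex.I))) -
      Complex.exp χ * (h χ * hankelRay χ α (Complex.exp ((-θ : ℝ) * Complex.I))) =
      2 * Real.pi * Complex.I * h χ * χ ^ α / Complex.Gamma α := by
    rw [← mul_sub, ← mul_sub, hH, Complex.exp_neg]
    have := Complex.exp_ne_zero χ
    field_simp
  rw [e1] at h3
  refine h3.congr' ?_
  filter_upwards [eventually_laplaceRay_eq hδ hχ hf hg hs hα0 hθ1 hne1,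
    eventually_laplaceRay_eq hδ hχ hf hg hs hα0 hθ2 hne2] with ε h4 h5
  obtain ⟨P, hP⟩ := exists_primitive_of_starConvex (isOpen_borelDomain hδ hχ)
    (starConvex_borelDomain hχ) (f := fun w => Complex.exp (-w / (ε : ℂ)) * f w)
    (DifferentiableOn.mul (by fun_prop) hf)
  have h6 := h4 P hP
  have h7 := h5 P hP
  linear_combination (-(ε : ℂ) ^ (α - 1) * Complex.exp (χ / ε)) * (h6 - h7)

/-! ### Late coefficients and the amplitude of the singularity -/

/-- The coefficient `α (α + 1) ⋯ (α + n - 1) / n!` of `w ^ n` in `(1 - w) ^ (-α)`. -/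
noncomputable def binomialCoeff {F : Type*} [Field F] (α : F) (n : ℕ) : F :=
  (∏ j ∈ Finset.range n, (α + j)) / (n.factorial : F)

theorem choose_eq_binomialCoeff (α : ℂ) (n : ℕ) :
    Ring.choose (α + n - 1) n = binomialCoeff α n := by
  rw [binomialCoeff, Ring.choose_eq_smul, smul_eq_mul, div_eq_inv_mul]
  congr 1
  rw [Polynomial.descPochhammer_smeval_eq_ascPochhammer, Polynomial.ascPochhammer_smeval_cast,
    Polynomial.ascPochhammer_smeval_eq_eval, show α + n - 1 - n + 1 = α by ring]
  induction n with
  | zero => simp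
  | succ k ih => rw [ascPochhammer_succ_eval, ih, Finset.prod_range_succ]

theorem hasSum_binomialCoeff (α : ℂ) {w : ℂ} (hw : ‖w‖ < 1) :
    HasSum (fun n => binomialCoeff α n * w ^ n) ((1 - w) ^ (-α)) := by
  have h := (Complex.one_div_one_sub_cpow_hasFPowerSeriesOnBall_zero α).hasSum (y := w) (by
    rw [Metric.mem_eball, edist_zero_right, ← ofReal_norm]
    exact ENNReal.ofReal_lt_one.2 hw)
  rw [zero_add, one_div, ← Complex.cpow_neg] at h
  have e : (fun n => binomialCoeff α n * w ^ n) = fun n : ℕ =>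
      FormalMultilinearSeries.ofScalars ℂ (fun n : ℕ => Ring.choose (α + n - 1) n) n
        fun _ => w := by
    ext n
    rw [FormalMultilinearSeries.ofScalars_apply_eq, choose_eq_binomialCoeff, smul_eq_mul]
  rw [e]
  exact h

theorem tendsto_binomialCoeff_div {α : ℂ} (hα : 0 < α.re) :
    Tendsto (fun n : ℕ => binomialCoeff α n / (n : ℂ) ^ (α - 1)) atTop
      (𝓝 (1 / Complex.Gamma α)) := by
  have hΓ := Complex.Gamma_ne_zero_of_re_pos hα
  have h1 := (tendsto_const_nhds (x := (1 : ℂ))).div (Complex.GammaSeq_tendsto_Gamma α) hΓ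
  have h2 : Tendsto (fun n : ℕ => (n : ℂ) / (α + n)) atTop (𝓝 1) := by
    have := tendsto_natCast_div_add_atTop (𝕜 := ℂ) α
    simpa [add_comm] using this
  have h3 := h2.mul h1
  rw [one_mul] at h3
  refine h3.congr' ?_
  filter_upwards [eventually_gt_atTop 0] with n hn
  have hn' : (n : ℂ) ≠ 0 := Nat.cast_ne_zero.2 hn.ne'
  have hprod : ∀ m : ℕ, α + m ≠ 0 := by
    intro m h
    have := congrArg Complex.re h
    simp at this
    have : (0 : ℝ) ≤ m := Nat.cast_nonneg m
    linarith
  have hP : ∏ j ∈ Finset.range n, (α + (j : ℂ)) ≠ 0 := Finset.prod_ne_zero_iff.2 fun j _ => hprod j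
  have hc : (n : ℂ) ^ α ≠ 0 := by
    rw [Complex.cpow_ne_zero_iff]; exact Or.inl hn'
  have hf : (n.factorial : ℂ) ≠ 0 := Nat.cast_ne_zero.2 n.factorial_ne_zero
  simp only [Pi.div_apply]
  rw [Complex.GammaSeq, Finset.prod_range_succ, binomialCoeff, Complex.cpow_sub _ _ hn',
    Complex.cpow_one]
  have := hprod n
  field_simp

theorem hasSum_binomialCoeff_real (σ : ℝ) {x : ℝ} (hx0 : 0 ≤ x) (hx : x < 1) :
    HasSum (fun n => binomialCoeff σ n * x ^ n) ((1 - x) ^ (-σ)) := by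
  have h := hasSum_binomialCoeff (σ : ℂ) (w := x) (by
    rwa [Complex.norm_real, Real.norm_of_nonneg hx0])
  rw [← Complex.hasSum_ofReal]
  rw [Complex.ofReal_cpow (by linarith)]
  push_cast
  convert h using 1
  ext n
  simp [binomialCoeff]

theorem binomialCoeff_nonneg {σ : ℝ} (hσ : 0 < σ) (n : ℕ) : 0 ≤ binomialCoeff σ n := by
  unfold binomialCoeff
  positivity

/-- Abelian theorem: coefficients that behave like `K n ^ (α - 1) / Γ(α)`, as those of
`K (1 - x) ^ (-α)` do, give a sum that behaves like `K (1 - x) ^ (-α)` at `1`. The error is compared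
with the series of `(1 - x) ^ (-Re α)`. -/
theorem tendsto_cpow_mul_of_tendsto_coeff {α K : ℂ} (hα : 0 < α.re) {b : ℕ → ℂ}
    (hb : Tendsto (fun n : ℕ => b n / (n : ℂ) ^ (α - 1)) atTop (𝓝 (K / Complex.Gamma α)))
    {F : ℝ → ℂ} (hF : ∀ x : ℝ, 0 < x → x < 1 → HasSum (fun n => b n * (x : ℂ) ^ n) (F x)) :
    Tendsto (fun x : ℝ => ((1 - x : ℝ) : ℂ) ^ α * F x) (𝓝[<] 1) (𝓝 K) := by
  set e : ℕ → ℂ := fun n => b n - K * binomialCoeff α n with he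
  have he0 : Tendsto (fun n : ℕ => e n / (n : ℂ) ^ (α - 1)) atTop (𝓝 0) := by
    have h1 := hb.sub ((tendsto_binomialCoeff_div hα).const_mul K)
    rw [mul_one_div, sub_self] at h1
    refine h1.congr fun n => ?_
    rw [he]; ring
  have hreal : Tendsto (fun n : ℕ => ‖(binomialCoeff α.re n : ℝ) / (n : ℝ) ^ (α.re - 1)‖) atTop
      (𝓝 ‖1 / Complex.Gamma (α.re : ℂ)‖) := by
    have h1 := (tendsto_binomialCoeff_div (α := (α.re : ℂ)) (by simpa using hα)).norm
    refine h1.congr fun n => ?_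
    rw [← Complex.norm_real]
    congr 1
    push_cast
    rw [Complex.ofReal_cpow (Nat.cast_nonneg n)]
    simp [binomialCoeff]
  have hratio : Tendsto (fun n : ℕ => ‖e n‖ / binomialCoeff α.re n) atTop (𝓝 0) := by
    have h1 := he0.norm.div hreal (by
      have := Complex.Gamma_ne_zero_of_re_pos (s := (α.re : ℂ)) (by simpa using hα)
      simpa using this)
    rw [norm_zero, zero_div] at h1
    refine h1.congr' ?_
    filter_upwards [eventually_gt_atTop 0] with n hn
    have hn' : (0 : ℝ) < n := Nat.cast_pos.2 hn
    have h2 := Complex.norm_cpow_eq_rpow_re_of_pos hn' (α - 1)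
    rw [Complex.ofReal_natCast] at h2
    simp only [Pi.div_apply]
    rw [norm_div, h2, norm_div, Real.norm_of_nonneg (binomialCoeff_nonneg hα n),
      Real.norm_of_nonneg (by positivity), Complex.sub_re, Complex.one_re]
    have : (n : ℝ) ^ (α.re - 1) ≠ 0 := by positivity
    field_simp
  have hone : Tendsto (fun x : ℝ => (1 - x) ^ α.re) (𝓝[<] 1) (𝓝 0) := by
    have hc : ContinuousAt (fun x : ℝ => (1 - x) ^ α.re) 1 :=
      ContinuousAt.rpow_const (by fun_prop) (Or.inr hα.le)
    have := hc.tendsto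
    rw [sub_self, Real.zero_rpow hα.ne'] at this
    exact this.mono_left nhdsWithin_le_nhds
  have hIoo : ∀ᶠ x : ℝ in 𝓝[<] 1, x ∈ Ioo (0 : ℝ) 1 := Ioo_mem_nhdsLT zero_lt_one
  rw [tendsto_iff_norm_sub_tendsto_zero]
  refine (Metric.tendsto_nhds.2 fun η hη => ?_)
  obtain ⟨N, hN⟩ := eventually_atTop.1 (hratio.eventually_lt_const (half_pos hη))
  set S := ∑ n ∈ Finset.range N, ‖e n‖ with hS
  have hS0 : 0 ≤ S := Finset.sum_nonneg fun _ _ => norm_nonneg _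
  have hsmall : ∀ᶠ x : ℝ in 𝓝[<] 1, (1 - x) ^ α.re * S < η / 2 := by
    have := hone.mul_const S
    rw [zero_mul] at this
    exact this.eventually_lt_const (half_pos hη)
  filter_upwards [hIoo, hsmall] with x hx hxS
  have hx1 : 0 < 1 - x := sub_pos.2 hx.2
  have hxn : ‖(x : ℂ)‖ < 1 := by rw [Complex.norm_real, Real.norm_of_nonneg hx.1.le]; exact hx.2
  have hsum : HasSum (fun n => e n * (x : ℂ) ^ n) (F x - K * (1 - (x : ℂ)) ^ (-α)) := by
    have := (hF x hx.1 hx.2).sub ((hasSum_binomialCoeff α hxn).mul_left K)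
    have e1 : (fun n => e n * (x : ℂ) ^ n) =
        fun n => b n * (x : ℂ) ^ n - K * (binomialCoeff α n * (x : ℂ) ^ n) := by
      ext n
      rw [he]; ring
    rw [e1]
    exact this
  have hr := hasSum_binomialCoeff_real α.re hx.1.le hx.2
  have hfin : HasSum (fun n => if n ∈ Finset.range N then ‖e n‖ else 0) S := by
    have : HasSum (fun n => if n ∈ Finset.range N then ‖e n‖ else 0)
        (∑ n ∈ Finset.range N, if n ∈ Finset.range N then ‖e n‖ else 0) :=
      hasSum_sum_of_ne_finset_zero fun n hn => if_neg hn
    rwa [Finset.sum_congr rfl fun n hn => if_pos hn] at this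
  have hle : ‖F x - K * (1 - (x : ℂ)) ^ (-α)‖ ≤ η / 2 * (1 - x) ^ (-α.re) + S := by
    rw [← hsum.tsum_eq]
    refine tsum_of_norm_bounded ((hr.mul_left (η / 2)).add hfin) fun n => ?_
    have hxn0 : 0 ≤ x ^ n := pow_nonneg hx.1.le n
    have hbn := binomialCoeff_nonneg hα n
    rw [norm_mul, norm_pow, Complex.norm_real, Real.norm_of_nonneg hx.1.le]
    split_ifs with hn
    · have : ‖e n‖ * x ^ n ≤ ‖e n‖ :=
        mul_le_of_le_one_right (norm_nonneg _) (pow_le_one₀ hx.1.le hx.2.le)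
      have : 0 ≤ η / 2 * (binomialCoeff α.re n * x ^ n) := by positivity
      linarith
    · have hnN := hN n (by simpa using hn)
      have hpos : 0 < binomialCoeff α.re n := by
        unfold binomialCoeff
        refine div_pos (Finset.prod_pos fun j _ => by positivity) (by positivity)
      rw [div_lt_iff₀ hpos] at hnN
      rw [add_zero, ← mul_assoc]
      gcongr
  have hcp : ((1 - x : ℝ) : ℂ) ^ α * (1 - (x : ℂ)) ^ (-α) = 1 := by
    rw [show 1 - (x : ℂ) = ((1 - x : ℝ) : ℂ) by push_cast; ring, ← Complex.cpow_add _ _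
      (Complex.ofReal_ne_zero.2 hx1.ne'), add_neg_cancel, Complex.cpow_zero]
  have e1 : ((1 - x : ℝ) : ℂ) ^ α * F x - K =
      ((1 - x : ℝ) : ℂ) ^ α * (F x - K * (1 - (x : ℂ)) ^ (-α)) := by
    linear_combination K * hcp
  rw [Real.dist_eq, sub_zero, abs_norm, e1, norm_mul, Complex.norm_cpow_eq_rpow_re_of_pos hx1]
  calc (1 - x) ^ α.re * ‖F x - K * (1 - (x : ℂ)) ^ (-α)‖
      ≤ (1 - x) ^ α.re * (η / 2 * (1 - x) ^ (-α.re) + S) := by gcongr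
    _ = η / 2 * ((1 - x) ^ α.re * (1 - x) ^ (-α.re)) + (1 - x) ^ α.re * S := by ring
    _ = η / 2 + (1 - x) ^ α.re * S := by
        rw [← Real.rpow_add hx1, add_neg_cancel, Real.rpow_zero, mul_one]
    _ < η := by linarith

/-- The Taylor coefficients of `f` at `0` grow like those of `K (1 - w / χ) ^ (-α)`. -/
def HasLateCoefficients (f : ℂ → ℂ) (χ α K : ℂ) : Prop :=
  Tendsto (fun n : ℕ => iteratedDeriv n f 0 / (n.factorial : ℂ) * χ ^ n / (n : ℂ) ^ (α - 1)) atTop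
    (𝓝 (K / Complex.Gamma α))

/-- The growth of the Taylor coefficients determines the amplitude of the singularity, whatever
other singularities there are on the circle of convergence: let `w → χ` radially. -/
theorem HasSingularExpansion.amplitude_eq {f h g : ℂ → ℂ} {δ : ℝ}
    {χ α K : ℂ} (hχ : χ ∈ openSector δ) (hf : DifferentiableOn ℂ f (borelDomain δ χ))
    (hs : HasSingularExpansion f χ α h g) (hα : 0 < α.re) (hK : HasLateCoefficients f χ α K) :
    h χ = K := by
  have hn := norm_pos_iff.2 hχ.1
  have hmem : ∀ x : ℝ, 0 < x → x < 1 → (x : ℂ) * χ ∈ Metric.ball (0 : ℂ) ‖χ‖ := by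
    intro x hx hx1
    rw [mem_ball_zero_iff, norm_mul, Complex.norm_real, Real.norm_of_nonneg hx.le]
    nlinarith
  have h1 := tendsto_cpow_mul_of_tendsto_coeff hα hK (F := fun x => f (x * χ)) (by
    intro x hx hx1
    have h2 := Complex.hasSum_taylorSeries_on_ball (f := f) (c := 0) (r := ‖χ‖)
      (hf.mono (ball_subset_borelDomain hχ)) (hmem x hx hx1)
    have e1 : (fun n : ℕ => iteratedDeriv n f 0 / (n.factorial : ℂ) * χ ^ n * (x : ℂ) ^ n) =
        fun n : ℕ => (n.factorial : ℂ)⁻¹ • ((x : ℂ) * χ - 0) ^ n • iteratedDeriv n f 0 := by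
      ext n
      rw [sub_zero, smul_eq_mul, smul_eq_mul, mul_pow]
      ring
    rw [e1]
    exact h2)
  refine tendsto_nhds_unique ?_ h1
  have hw : Tendsto (fun x : ℝ => (x : ℂ) * χ) (𝓝[<] 1) (𝓝 χ) := by
    have hc : Continuous (fun x : ℝ => (x : ℂ) * χ) := by fun_prop
    exact (hc.tendsto' 1 χ (by simp)).mono_left nhdsWithin_le_nhds
  have hpow : Tendsto (fun x : ℝ => ((1 - x : ℝ) : ℂ) ^ α) (𝓝[<] 1) (𝓝 0) := by
    rw [tendsto_zero_iff_norm_tendsto_zero]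
    have hc : ContinuousAt (fun x : ℝ => (1 - x) ^ α.re) 1 :=
      ContinuousAt.rpow_const (by fun_prop) (Or.inr hα.le)
    have := hc.tendsto
    rw [sub_self, Real.zero_rpow hα.ne'] at this
    refine (this.mono_left nhdsWithin_le_nhds).congr' ?_
    filter_upwards [self_mem_nhdsWithin] with x hx
    rw [Complex.norm_cpow_eq_rpow_re_of_pos (sub_pos.2 hx)]
  have h3 := (hs.analyticAt_amplitude.continuousAt.tendsto.comp hw).add
    (hpow.mul (hs.analyticAt_regular.continuousAt.tendsto.comp hw))
  rw [zero_mul, add_zero] at h3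
  refine h3.congr' ?_
  filter_upwards [hw.eventually hs.eventually_eq, Ioo_mem_nhdsLT zero_lt_one] with x hx hx1
  have hcut := (ball_subset_borelDomain hχ (hmem x hx1.1 hx1.2)).2
  have hx0 : ((1 - x : ℝ) : ℂ) ≠ 0 := Complex.ofReal_ne_zero.2 (sub_pos.2 hx1.2).ne'
  have hcp : ((1 - x : ℝ) : ℂ) ^ α * ((1 - x : ℝ) : ℂ) ^ (-α) = 1 := by
    rw [← Complex.cpow_add _ _ hx0, add_neg_cancel, Complex.cpow_zero]
  have e1 : 1 - (x : ℂ) * χ / χ = ((1 - x : ℝ) : ℂ) := by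
    rw [mul_div_cancel_right₀ _ hχ.1]
    push_cast
    ring
  simp only [Function.comp_apply]
  rw [hx hcut, e1]
  linear_combination (-h ((x : ℂ) * χ)) * hcp

/-! ### The jump for singularities of arbitrary order -/

theorem rayPoint_mul_one_add {β t : ℝ} {ζ : ℂ} :
    rayPoint β t * (1 + ζ) = rayPoint (β + (1 + ζ).arg) (t * ‖1 + ζ‖) := by
  conv_lhs => rw [← Complex.norm_mul_exp_arg_mul_I (1 + ζ)]
  rw [rayPoint, rayPoint]
  push_cast
  rw [add_mul, Complex.exp_add]
  ring

/-- Growth in the sector passes to the derivative, by Cauchy's estimate on discs whose radius is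
proportional to the distance from `0`. -/
theorem SectorialGrowth.deriv {f : ℂ → ℂ} {δ : ℝ} (hδ : δ ≤ Real.pi / 2) {χ : ℂ}
    (hχ : χ ∈ openSector δ) (hf : DifferentiableOn ℂ f (borelDomain δ χ))
    (hg : SectorialGrowth f δ χ.arg) : SectorialGrowth (deriv f) δ χ.arg := by
  intro K hK hKs
  have hn := norm_pos_iff.2 hχ.1
  have hO : IsOpen {β : ℝ | |β| < δ ∧ β ≠ χ.arg} :=
    (isOpen_lt continuous_abs continuous_const).inter isOpen_ne
  obtain ⟨κ, hκ, hKκ⟩ := hK.exists_cthickening_subset_open hO hKs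
  obtain ⟨C, B, hC, hB, hCB⟩ := hg _ (hK.cthickening (r := κ)) fun β hβ => hKκ hβ
  have harg : ∀ᶠ ζ : ℂ in 𝓝 0, |(1 + ζ).arg| < κ := by
    have hc : ContinuousAt (fun ζ : ℂ => |(1 + ζ).arg|) 0 :=
      ((Complex.continuousAt_arg (x := 1 + 0) (by simp)).comp (f := fun ζ : ℂ => 1 + ζ)
        (by fun_prop)).abs
    exact hc.eventually_lt_const (by simpa using hκ)
  obtain ⟨k₀, hk₀, hball⟩ := Metric.eventually_nhds_iff_ball.1 harg
  set k := min (k₀ / 2) (1 / 2) with hk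
  have hk0 : 0 < k := by positivity
  have hk1 : k ≤ 1 / 2 := min_le_right _ _
  have hkarg : ∀ ζ : ℂ, ‖ζ‖ ≤ k → |(1 + ζ).arg| < κ := by
    intro ζ hζ
    refine hball ζ ?_
    rw [mem_ball_zero_iff]
    have := min_le_left (k₀ / 2) (1 / 2)
    linarith
  have hpolar : ∀ β ∈ K, ∀ t : ℝ, 0 < t → ∀ w ∈ Metric.closedBall (rayPoint β t) (k * t),
      ∃ β' ∈ Metric.cthickening κ K, ∃ r : ℝ, 0 < r ∧ r ≤ 2 * t ∧ w = rayPoint β' r := by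
    intro β hβ t ht w hw
    have h0 := rayPoint_ne_zero β ht
    set ζ := (w - rayPoint β t) / rayPoint β t with hζ
    have hζk : ‖ζ‖ ≤ k := by
      rw [hζ, norm_div, norm_rayPoint β ht.le, div_le_iff₀ ht]
      exact mem_closedBall_iff_norm.1 hw
    have hwe : w = rayPoint β t * (1 + ζ) := by
      rw [hζ]; field_simp; ring
    have h1 : 1 - ‖ζ‖ ≤ ‖1 + ζ‖ := by
      have := norm_sub_norm_le (1 : ℂ) (-ζ)
      rwa [norm_one, norm_neg, sub_neg_eq_add] at this
    have h2 : ‖1 + ζ‖ ≤ 1 + ‖ζ‖ := by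
      have := norm_add_le (1 : ℂ) ζ
      rwa [norm_one] at this
    refine ⟨β + (1 + ζ).arg, ?_, t * ‖1 + ζ‖, ?_, ?_, hwe.trans rayPoint_mul_one_add⟩
    · refine Metric.mem_cthickening_of_dist_le _ β κ K hβ ?_
      rw [Real.dist_eq, add_sub_cancel_left]
      exact (hkarg ζ hζk).le
    · exact mul_pos ht (by linarith)
    · nlinarith
  have hfd : DifferentiableOn ℂ (_root_.deriv f) (borelDomain δ χ) :=
    hf.deriv (isOpen_borelDomain hδ hχ)
  obtain ⟨M, hM⟩ := (isCompact_closedBall (0 : ℂ) (‖χ‖ / 2)).exists_bound_of_continuousOn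
    (hfd.continuousOn.mono ((Metric.closedBall_subset_ball (by linarith)).trans
      (ball_subset_borelDomain hχ)))
  have hM0 : 0 ≤ M := (norm_nonneg _).trans (hM 0 (Metric.mem_closedBall_self (by positivity)))
  set t₀ := ‖χ‖ / 2 with ht₀
  have ht₀0 : 0 < t₀ := by positivity
  refine ⟨M + C / (k * t₀), 2 * B, by positivity, by positivity, fun β hβ t ht => ?_⟩
  have hexp : 1 ≤ Real.exp (2 * B * t) := Real.one_le_exp (by positivity)
  have hC0 : 0 ≤ C / (k * t₀) := by positivity
  rcases le_total t t₀ with h | h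
  · have h1 := hM (rayPoint β t) (by rwa [mem_closedBall_zero_iff, norm_rayPoint β ht.le])
    nlinarith
  · have h1 : ‖_root_.deriv f (rayPoint β t)‖ ≤ C * Real.exp (2 * B * t) / (k * t) := by
      refine Complex.norm_deriv_le_of_forall_mem_sphere_norm_le (by positivity) ?_ ?_
      · refine DifferentiableOn.diffContOnCl ?_
        rw [closure_ball _ (by positivity)]
        refine hf.mono fun w hw => ?_
        obtain ⟨β', hβ', r, hr, -, rfl⟩ := hpolar β hβ t ht w hw
        exact rayPoint_mem_borelDomain hδ (hKκ hβ').1 (hKκ hβ').2 hr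
      · intro w hw
        obtain ⟨β', hβ', r, hr, hr2, rfl⟩ := hpolar β hβ t ht w
          (Metric.sphere_subset_closedBall hw)
        refine (hCB β' hβ' r hr).trans ?_
        gcongr C * Real.exp ?_
        nlinarith
    refine h1.trans ?_
    have h2 : C * Real.exp (2 * B * t) / (k * t) ≤ C * Real.exp (2 * B * t) / (k * t₀) := by
      gcongr
    refine h2.trans ?_
    rw [mul_div_right_comm]
    gcongr
    exact le_add_of_nonneg_left hM0

/-- The derivative of `f` has a singularity of order `α + 1`, with amplitude `α / χ * h χ`. -/
theorem HasSingularExpansion.deriv {f h g : ℂ → ℂ} {χ α : ℂ} (hχ : χ ≠ 0)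
    (hs : HasSingularExpansion f χ α h g) :
    HasSingularExpansion (deriv f) χ (α + 1)
      (fun w => α / χ * h w + (1 - w / χ) * deriv h w) (deriv g) := by
  refine ⟨?_, hs.analyticAt_regular.deriv, ?_⟩
  · refine (analyticAt_const.mul hs.analyticAt_amplitude).add
      (AnalyticAt.mul ?_ hs.analyticAt_amplitude.deriv)
    exact analyticAt_const.sub (analyticAt_id.div analyticAt_const hχ)
  · filter_upwards [hs.eventually_eq.eventually_nhds,
      hs.analyticAt_amplitude.eventually_analyticAt, hs.analyticAt_regular.eventually_analyticAt]
      with w h1 h2 h3 hw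
    have hslit : 1 - w / χ ∈ Complex.slitPlane := by
      by_contra hcon
      exact hw ((mem_singularCut_iff hχ).2 hcon)
    have hev : f =ᶠ[𝓝 w] fun w => (1 - w / χ) ^ (-α) * h w + g w := by
      have hc : ContinuousAt (fun w : ℂ => 1 - w / χ) w := by fun_prop
      filter_upwards [h1, hc.eventually (Complex.isOpen_slitPlane.mem_nhds hslit)] with x hx hx2
      refine hx fun hcut => (mem_singularCut_iff hχ).1 hcut hx2
    have hne : 1 - w / χ ≠ 0 := Complex.slitPlane_ne_zero hslit
    have hlin : HasDerivAt (fun w : ℂ => 1 - w / χ) (-(1 / χ)) w :=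
      ((hasDerivAt_id w).div_const χ).const_sub 1
    have hpow := hlin.cpow_const (c := -α) hslit
    have hder := (hpow.mul h2.differentiableAt.hasDerivAt).add h3.differentiableAt.hasDerivAt
    have e1 : (1 - w / χ) ^ (-α) = (1 - w / χ) ^ (-(α + 1)) * (1 - w / χ) := by
      rw [show -α = -(α + 1) + 1 by ring, Complex.cpow_add _ _ hne, Complex.cpow_one]
    rw [hev.deriv_eq]
    refine hder.deriv.trans ?_
    rw [show -α - 1 = -(α + 1) by ring, e1]
    ring

theorem HasLateCoefficients.deriv {f : ℂ → ℂ} {χ α K : ℂ} (hχ : χ ≠ 0) (hα : α ≠ 0)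
    (hK : HasLateCoefficients f χ α K) :
    HasLateCoefficients (deriv f) χ (α + 1) (α * K / χ) := by
  have h1 := (tendsto_add_atTop_iff_nat 1).2 hK
  have h2 : Tendsto (fun n : ℕ => ((1 + 1 / (n : ℝ) : ℝ) : ℂ) ^ α) atTop (𝓝 1) := by
    have h3 : Tendsto (fun n : ℕ => ((1 + 1 / (n : ℝ) : ℝ) : ℂ)) atTop (𝓝 1) := by
      have := (tendsto_one_div_atTop_nhds_zero_nat (𝕜 := ℝ)).const_add 1
      rw [add_zero] at this
      exact (Complex.continuous_ofReal.tendsto' 1 1 (by simp)).comp this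
    have h4 := (continuousAt_cpow_const (b := α) (a := 1) (by simp)).tendsto.comp h3
    rwa [Complex.one_cpow] at h4
  have h5 := (h2.mul h1).mul_const χ⁻¹
  unfold HasLateCoefficients
  have e1 : α * K / χ / Complex.Gamma (α + 1) = 1 * (K / Complex.Gamma α) * χ⁻¹ := by
    rw [Complex.Gamma_add_one α hα]
    field_simp
  rw [e1]
  refine h5.congr' ?_
  filter_upwards [eventually_gt_atTop 0] with n hn
  have hn' : (0 : ℝ) < n := Nat.cast_pos.2 hn
  have hnc : (n : ℂ) ≠ 0 := Nat.cast_ne_zero.2 hn.ne'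
  have hn1 : ((n : ℂ) + 1) ≠ 0 := by exact_mod_cast n.succ_ne_zero
  have e2 : ((n : ℂ) + 1) ^ α = (n : ℂ) ^ α * ((1 + 1 / (n : ℝ) : ℝ) : ℂ) ^ α := by
    have h6 := ofReal_mul_cpow hn' (u := ((1 + 1 / (n : ℝ) : ℝ) : ℂ))
      (Complex.ofReal_ne_zero.2 (by positivity)) α
    rw [Complex.ofReal_natCast] at h6
    rw [← h6]
    congr 1
    push_cast
    field_simp
  have hpow : (n : ℂ) ^ α ≠ 0 := by
    rw [Complex.cpow_ne_zero_iff]; exact Or.inl hnc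
  have hpow1 : ((n : ℂ) + 1) ^ α ≠ 0 := by
    rw [Complex.cpow_ne_zero_iff]; exact Or.inl hn1
  have hfac : (n.factorial : ℂ) ≠ 0 := Nat.cast_ne_zero.2 n.factorial_ne_zero
  have e3 : ((1 + 1 / (n : ℝ) : ℝ) : ℂ) ^ α = ((n : ℂ) + 1) ^ α / (n : ℂ) ^ α := by
    rw [e2]; field_simp
  rw [e3, iteratedDeriv_succ', Nat.factorial_succ, add_sub_cancel_right]
  push_cast
  rw [Complex.cpow_sub _ _ hn1, Complex.cpow_one]
  field_simp
  ring

/-- Integration by parts along a ray. -/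
theorem eventually_laplaceRay_deriv {f : ℂ → ℂ} {δ : ℝ} (hδ : δ ≤ Real.pi / 2)
    {χ : ℂ} (hχ : χ ∈ openSector δ) (hf : DifferentiableOn ℂ f (borelDomain δ χ))
    (hg : SectorialGrowth f δ χ.arg) {θ : ℝ} (hθ : |θ| < δ) (hne : θ ≠ χ.arg) :
    ∀ᶠ ε : ℝ in 𝓝[>] 0, laplaceRay f θ ε = ε * laplaceRay (deriv f) θ ε + ε * f 0 := by
  obtain ⟨C₁, B₁, hC₁, hB₁, h₁⟩ := hg {θ} isCompact_singleton (by simpa using ⟨hθ, hne⟩)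
  obtain ⟨C₂, B₂, hC₂, hB₂, h₂⟩ := hg.deriv hδ hχ hf {θ} isCompact_singleton
    (by simpa using ⟨hθ, hne⟩)
  have hcos := Real.cos_pos_of_mem_Ioo (x := θ) (abs_lt.1 (hθ.trans_le hδ))
  have hdiv := tendsto_const_div_nhdsGT_zero hcos
  have hopen := isOpen_borelDomain hδ hχ
  filter_upwards [hdiv.eventually_ge_atTop (B₁ + 1), hdiv.eventually_ge_atTop (B₂ + 1),
    self_mem_nhdsWithin] with ε h3 h4 hε
  have hε' : (ε : ℂ) ≠ 0 := Complex.ofReal_ne_zero.2 (ne_of_gt hε)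
  set d := Complex.exp (θ * Complex.I) with hd
  have hI₁ := integrableOn_laplace hδ hf.continuousOn hθ hne hC₁ (h₁ θ rfl) h3
  have hI₂ := integrableOn_laplace hδ (hf.deriv hopen).continuousOn hθ hne hC₂ (h₂ θ rfl) h4
  have hder : ∀ t ∈ Ici (0 : ℝ), HasDerivAt
      (fun t : ℝ => Complex.exp (-(rayPoint θ t) / (ε : ℂ)) * f (rayPoint θ t))
      (-(1 / (ε : ℂ)) * (Complex.exp (-(rayPoint θ t) / (ε : ℂ)) * f (rayPoint θ t) * d) +
        Complex.exp (-(rayPoint θ t) / (ε : ℂ)) * deriv f (rayPoint θ t) * d) t := by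
    intro t ht
    have hmem : rayPoint θ t ∈ borelDomain δ χ := by
      have := translate_mem_borelDomain' hδ hχ hθ hne le_rfl one_pos ht
      rwa [Complex.ofReal_zero, zero_mul, zero_add] at this
    have hray : HasDerivAt (fun t : ℝ => rayPoint θ t) d t := by
      simpa [rayPoint] using ((Complex.ofRealCLM.hasDerivAt (x := t)).mul_const d)
    have h5 : HasDerivAt (fun w : ℂ => Complex.exp (-w / (ε : ℂ)) * f w)
        (Complex.exp (-(rayPoint θ t) / (ε : ℂ)) * (-1 / (ε : ℂ)) * f (rayPoint θ t) +
          Complex.exp (-(rayPoint θ t) / (ε : ℂ)) * deriv f (rayPoint θ t)) (rayPoint θ t) :=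
      ((hasDerivAt_id _).neg.div_const _).cexp.mul
        (hf.differentiableAt (hopen.mem_nhds hmem)).hasDerivAt
    refine (h5.comp t hray).congr_deriv ?_
    ring
  have hlim : Tendsto (fun t : ℝ => Complex.exp (-(rayPoint θ t) / (ε : ℂ)) * f (rayPoint θ t))
      atTop (𝓝 0) := by
    have h6 : Tendsto (fun t : ℝ => C₁ * Real.exp (-1 * t)) atTop (𝓝 0) := by
      have := (Real.tendsto_exp_neg_atTop_nhds_zero).const_mul C₁
      simpa using this
    refine squeeze_zero_norm' ?_ h6
    filter_upwards [eventually_gt_atTop 0] with t ht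
    have h7 := norm_laplace_integrand_le (c := 1) ht (h₁ θ rfl t ht) (le_sub_iff_add_le'.2 h3) hC₁
    rwa [norm_mul, Complex.norm_exp_ofReal_mul_I, mul_one] at h7
  have key := integral_Ioi_of_hasDerivAt_of_tendsto' hder ((hI₁.const_mul _).add hI₂) hlim
  rw [integral_add (hI₁.const_mul _) hI₂, integral_const_mul] at key
  have h0 : rayPoint θ 0 = 0 := by simp [rayPoint]
  rw [h0, neg_zero, zero_div, Complex.exp_zero, one_mul, zero_sub] at key
  change -(1 / (ε : ℂ)) * laplaceRay f θ ε + laplaceRay (deriv f) θ ε = -f 0 at key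
  have h8 : laplaceRay f θ ε = ε * (1 / ε * laplaceRay f θ ε) := by field_simp
  linear_combination h8 - ε * key

/-- The jump of the Laplace integral across a singularity whose amplitude is known from the late
coefficients. Differentiation raises the order `α` by one and, by parts, divides the jump by `ε`;
so it is enough to treat `Re α > 1`. -/
theorem tendsto_jump_of_lateCoefficients {δ : ℝ} (hδ : δ ≤ Real.pi / 2) {χ : ℂ}
    (hχ : χ ∈ openSector δ) {θ : ℝ} (hθ : θ < δ) (hχθ : |χ.arg| < θ) (m : ℕ) :
    ∀ (f h g : ℂ → ℂ) (α K : ℂ), 1 < α.re + m → (∀ k : ℕ, α ≠ -(k : ℂ)) →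
    DifferentiableOn ℂ f (borelDomain δ χ) → SectorialGrowth f δ χ.arg →
    HasSingularExpansion f χ α h g → HasLateCoefficients f χ α K →
    Tendsto (fun ε : ℝ => (ε : ℂ) ^ (α - 1) * Complex.exp (χ / ε) *
      (laplaceRay f θ ε - laplaceRay f (-θ) ε)) (𝓝[>] 0)
      (𝓝 (2 * Real.pi * Complex.I * K * χ ^ α / Complex.Gamma α)) := by
  have hθ0 : 0 < θ := (abs_nonneg _).trans_lt hχθ
  have hθ1 : |θ| < δ := by rwa [abs_of_pos hθ0]
  have hθ2 : |-θ| < δ := by rwa [abs_neg]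
  have hne1 : θ ≠ χ.arg := fun h => by rw [← h, abs_of_pos hθ0] at hχθ; exact hχθ.false
  have hne2 : -θ ≠ χ.arg := fun h => by rw [← h, abs_neg, abs_of_pos hθ0] at hχθ; exact hχθ.false
  induction m with
  | zero =>
    intro f h g α K hα _ hf hg hs hK
    rw [Nat.cast_zero, add_zero] at hα
    have hhK := hs.amplitude_eq hχ hf (by linarith) hK
    rw [← hhK]
    exact hs.tendsto_jump hδ hχ hf hg hα hθ hχθ
  | succ m ih =>
    intro f h g α K hα hαk hf hg hs hK
    have hα0 : α ≠ 0 := by simpa using hαk 0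
    have h1 := ih _ _ _ (α + 1) (α * K / χ) (by push_cast at hα; simp; linarith)
      (fun k hk => hαk (k + 1) (by push_cast; linear_combination hk))
      (hf.deriv (isOpen_borelDomain hδ hχ)) (hg.deriv hδ hχ hf) (hs.deriv hχ.1)
      (hK.deriv hχ.1 hα0)
    have e1 : 2 * Real.pi * Complex.I * (α * K / χ) * χ ^ (α + 1) / Complex.Gamma (α + 1) =
        2 * Real.pi * Complex.I * K * χ ^ α / Complex.Gamma α := by
      have := hχ.1
      rw [Complex.Gamma_add_one α hα0, Complex.cpow_add _ _ this, Complex.cpow_one]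
      field_simp
    rw [e1] at h1
    refine h1.congr' ?_
    filter_upwards [eventually_laplaceRay_deriv hδ hχ hf hg hθ1 hne1,
      eventually_laplaceRay_deriv hδ hχ hf hg hθ2 hne2, self_mem_nhdsWithin] with ε h2 h3 hε
    have hε' : (ε : ℂ) ≠ 0 := Complex.ofReal_ne_zero.2 (ne_of_gt hε)
    rw [h2, h3, add_sub_cancel_right, Complex.cpow_sub _ _ hε', Complex.cpow_one]
    field_simp
    ring

/-! ### Borel sums depending on a parameter -/

/-- The locally uniform bounds of Borel summability combine to one bound over a compact set of
directions, uniform near the parameter `z₁`. -/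
theorem exists_uniform_growth {yB : ℂ → ℂ → ℂ} {z₁ : ℂ} {K : Set ℝ} (hK : IsCompact K)
    (h : ∀ β ∈ K, BorelSummableAt yB β z₁) :
    ∃ C B : ℝ, 0 ≤ C ∧ 0 ≤ B ∧ ∀ᶠ z in 𝓝 z₁, ∀ β ∈ K, ∀ t : ℝ, 0 < t →
      ‖yB (rayPoint β t) z‖ ≤ C * Real.exp (B * t) := by
  refine hK.induction_on (p := fun K => ∃ C B : ℝ, 0 ≤ C ∧ 0 ≤ B ∧ ∀ᶠ z in 𝓝 z₁, ∀ β ∈ K,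
    ∀ t : ℝ, 0 < t → ‖yB (rayPoint β t) z‖ ≤ C * Real.exp (B * t)) ?_ ?_ ?_ ?_
  · exact ⟨0, 0, le_rfl, le_rfl, by simp⟩
  · rintro s t hst ⟨C, B, hC, hB, h1⟩
    exact ⟨C, B, hC, hB, h1.mono fun z hz β hβ => hz β (hst hβ)⟩
  · rintro s t ⟨C, B, hC, hB, h1⟩ ⟨C', B', hC', hB', h2⟩
    refine ⟨max C C', max B B', hC.trans (le_max_left _ _), hB.trans (le_max_left _ _), ?_⟩
    filter_upwards [h1, h2] with z h3 h4 β hβ r hr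
    rcases hβ with hβ | hβ
    · refine (h3 β hβ r hr).trans ?_
      gcongr
      · exact le_max_left _ _
      · exact le_max_left _ _
    · refine (h4 β hβ r hr).trans ?_
      gcongr
      · exact le_max_right _ _
      · exact le_max_right _ _
  · intro β hβ
    obtain ⟨C, B, hCB⟩ := h β hβ
    rw [nhds_prod_eq] at hCB
    obtain ⟨p, hp, q, hq, hpq⟩ := eventually_prod_iff.1 hCB
    refine ⟨{b | p b}, mem_nhdsWithin_of_mem_nhds hp, |C|, |B|, abs_nonneg _, abs_nonneg _, ?_⟩
    filter_upwards [hq] with z hz b hb t ht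
    refine (hpq hb hz t ht).trans ?_
    gcongr
    · exact le_abs_self C
    · exact le_abs_self B

section Parameter

variable {D : Set ℂ} {δ : ℝ} {χ : ℂ → ℂ} {y : ℕ → ℂ → ℂ} {yB : ℂ → ℂ → ℂ}

theorem IsParametricBorelTransform.differentiableOn_left
    (h : IsParametricBorelTransform D δ χ y yB) {z : ℂ} (hz : z ∈ D) :
    DifferentiableOn ℂ (fun w => yB w z) (borelDomain δ (χ z)) :=
  h.holomorphic.comp (f := fun w : ℂ => (w, z)) (by fun_prop) fun _ hw => ⟨hz, hw⟩

theorem IsParametricBorelTransform.differentiableAt_right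
    (h : IsParametricBorelTransform D δ χ y yB) (hD : IsOpen D) (hδ : δ ≤ Real.pi / 2)
    (hχ : DifferentiableOn ℂ χ D) (hχδ : ∀ z ∈ D, χ z ∈ openSector δ) {w z : ℂ} (hz : z ∈ D)
    (hw : w ∈ borelDomain δ (χ z)) : DifferentiableAt ℂ (fun z => yB w z) z := by
  have h1 := h.holomorphic.differentiableAt
    ((isOpen_setOf_mem_borelDomain hD hδ hχ.continuousOn hχδ).mem_nhds
      (show (w, z) ∈ _ from ⟨hz, hw⟩))
  exact DifferentiableAt.comp (f := fun z : ℂ => (w, z)) z h1 (by fun_prop)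

theorem continuousAt_arg_singularity (hD : IsOpen D) (hδ : δ ≤ Real.pi / 2)
    (hχ : DifferentiableOn ℂ χ D) (hχδ : ∀ z ∈ D, χ z ∈ openSector δ) {z : ℂ} (hz : z ∈ D) :
    ContinuousAt (fun z => (χ z).arg) z :=
  (Complex.continuousAt_arg (openSector_subset_slitPlane hδ (hχδ z hz))).comp
    (hχ.continuousOn.continuousAt (hD.mem_nhds hz))

/-- Away from the singular direction the Borel sum exists and is holomorphic. -/
theorem eventually_borelSum_differentiableAt (hD : IsOpen D) (hδ : δ ≤ Real.pi / 2)
    (hy : DifferentiableOn ℂ (y 0) D)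
    (hχ : DifferentiableOn ℂ χ D) (hχδ : ∀ z ∈ D, χ z ∈ openSector δ)
    (hyB : IsParametricBorelTransform D δ χ y yB) {z₁ : ℂ} (hz₁ : z₁ ∈ D) {β : ℝ} (hβ : |β| < δ)
    (hne : β ≠ (χ z₁).arg) (hsum : BorelSummableAt yB β z₁) :
    ∀ᶠ p : ℝ × ℂ in 𝓝[>] (0 : ℝ) ×ˢ 𝓝 z₁,
      BorelSumExists yB β p.1 p.2 ∧ DifferentiableAt ℂ (borelSum y yB β p.1) p.2 := by
  obtain ⟨C, B, hC, hB, hgrow⟩ := exists_uniform_growth isCompact_singleton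
    (K := {β}) (by simpa using hsum)
  have hcos := Real.cos_pos_of_mem_Ioo (x := β) (abs_lt.1 (hβ.trans_le hδ))
  have hε : ∀ᶠ ε : ℝ in 𝓝[>] 0, B + 1 ≤ Real.cos β / ε :=
    (tendsto_const_div_nhdsGT_zero hcos).eventually_ge_atTop _
  have hargne : ∀ᶠ z in 𝓝 z₁, β ≠ (χ z).arg :=
    (continuousAt_arg_singularity hD hδ hχ hχδ hz₁).eventually_ne hne.symm |>.mono
      fun _ h => h.symm
  have hz := (((hD.eventually_mem hz₁).and hargne).and hgrow).eventually_nhds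
  filter_upwards [hε.prod_mk hz] with p hp
  obtain ⟨h1, h2⟩ := hp
  obtain ⟨r, hr, hball⟩ := Metric.eventually_nhds_iff_ball.1 h2
  have hint : ∀ z ∈ Metric.ball p.2 r, BorelSumExists yB β p.1 z := by
    intro z hz
    obtain ⟨⟨hzD, hne⟩, hg⟩ := hball z hz
    exact integrableOn_laplace hδ (hyB.differentiableOn_left hzD).continuousOn hβ hne hC
      (hg β rfl) h1
  have hp2 : p.2 ∈ Metric.ball p.2 r := Metric.mem_ball_self hr
  refine ⟨hint _ hp2, ?_⟩
  refine DifferentiableAt.add (hy.differentiableAt (hD.mem_nhds (hball _ hp2).1.1)) ?_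
  refine differentiableAt_integral_of_norm_le hr
    ((exp_neg_integrableOn_Ioi 0 one_pos).const_mul C) (fun z hz => (hint z hz).1) ?_ ?_
  · filter_upwards [ae_restrict_mem measurableSet_Ioi] with t ht z hz
    obtain ⟨⟨hzD, hne⟩, -⟩ := hball z hz
    refine DifferentiableAt.differentiableWithinAt ?_
    have h3 := hyB.differentiableAt_right hD hδ hχ hχδ hzD
      (rayPoint_mem_borelDomain hδ hβ hne ht)
    exact (h3.const_mul (Complex.exp (-(rayPoint β t) / (p.1 : ℂ)))).mul_const
      (Complex.exp (β * Complex.I))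
  · filter_upwards [ae_restrict_mem measurableSet_Ioi] with t ht z hz
    obtain ⟨-, hg⟩ := hball z hz
    exact norm_laplace_integrand_le (f := fun w => yB w z) (B := B) (c := 1) ht (hg β rfl t ht)
      (by linarith) hC

/-- The contour may be turned from `(0, ∞)` to the direction `β` when the singularity is not in
the sector between them. -/
theorem eventually_borelSum_eq (hD : IsOpen D) (hδ0 : 0 < δ) (hδ : δ ≤ Real.pi / 2)
    (hχ : DifferentiableOn ℂ χ D) (hχδ : ∀ z ∈ D, χ z ∈ openSector δ)
    (hyB : IsParametricBorelTransform D δ χ y yB) {z₁ : ℂ} (hz₁ : z₁ ∈ D) {β : ℝ} (hβ : |β| < δ)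
    (hne : (χ z₁).arg ∉ uIcc 0 β) (hsum : ∀ b ∈ uIcc 0 β, BorelSummableAt yB b z₁) :
    ∀ᶠ p : ℝ × ℂ in 𝓝[>] (0 : ℝ) ×ˢ 𝓝 z₁,
      BorelSumExists yB 0 p.1 p.2 ∧ borelSum y yB 0 p.1 p.2 = borelSum y yB β p.1 p.2 := by
  obtain ⟨C, B, hC, hB, hgrow⟩ := exists_uniform_growth isCompact_uIcc hsum
  have h0δ : |(0 : ℝ)| < δ := by simpa using hδ0
  have hcos := Real.cos_pos_of_mem_Ioo (x := β) (abs_lt.1 (hβ.trans_le hδ))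
  have hε : ∀ᶠ ε : ℝ in 𝓝[>] 0, B + 1 ≤ Real.cos β / ε :=
    (tendsto_const_div_nhdsGT_zero hcos).eventually_ge_atTop _
  have hargne : ∀ᶠ z in 𝓝 z₁, (χ z).arg ∉ uIcc 0 β :=
    (continuousAt_arg_singularity hD hδ hχ hχδ hz₁).eventually
      (isCompact_uIcc.isClosed.isOpen_compl.mem_nhds hne)
  have hz := ((hD.eventually_mem hz₁).and hargne).and hgrow
  filter_upwards [(hε.and self_mem_nhdsWithin).prod_mk hz] with p hp
  obtain ⟨ε, z⟩ := p
  obtain ⟨⟨h1, hε0⟩, ⟨hzD, hneK⟩, hg⟩ := hp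
  simp only at h1 hε0 hzD hneK hg ⊢
  have hε0' : 0 < ε := hε0
  have hχz := hχδ z hzD
  have hf := hyB.differentiableOn_left hzD
  have hneb : ∀ b ∈ uIcc 0 β, b ≠ (χ z).arg := fun b hb h => hneK (h ▸ hb)
  -- on the sector the decay of `exp (-w / ε)` is slowest in the direction `β`
  have hcos0 : B + 1 ≤ Real.cos 0 / ε := by
    refine h1.trans ?_
    rw [Real.cos_zero]
    gcongr
    exact Real.cos_le_one β
  have hI0 := integrableOn_laplace hδ hf.continuousOn h0δ (hneb 0 left_mem_uIcc) hC
    (hg 0 left_mem_uIcc) hcos0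
  have hIβ := integrableOn_laplace hδ hf.continuousOn hβ (hneb β right_mem_uIcc) hC
    (hg β right_mem_uIcc) h1
  refine ⟨hI0, ?_⟩
  obtain ⟨P, hP⟩ := exists_primitive_of_starConvex (isOpen_borelDomain hδ hχz)
    (starConvex_borelDomain hχz) (f := fun w => Complex.exp (-w / (ε : ℂ)) * yB w z)
    (DifferentiableOn.mul (by fun_prop) hf)
  have hb := tendsto_const_mul_exp_neg_mul_one_add C
  have hmem : ∀ b : ℝ, |b| < δ → b ≠ (χ z).arg → ∀ s : ℝ, 0 ≤ s →
      0 + (s : ℂ) * Complex.exp (b * Complex.I) ∈ borelDomain δ (χ z) := by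
    intro b hb hbne s hs
    have := translate_mem_borelDomain' hδ hχz hb hbne le_rfl one_pos hs
    rwa [Complex.ofReal_zero, zero_mul] at this
  have key := integral_ray_eq_of_primitive (P := P)
    (G := fun w => Complex.exp (-w / (ε : ℂ)) * yB w z)
    (v₁ := 0) (d₁ := Complex.exp ((0 : ℝ) * Complex.I)) (v₂ := 0)
    (d₂ := Complex.exp (β * Complex.I))
    (fun s hs => hP _ (hmem 0 h0δ (hneb 0 left_mem_uIcc) s hs))
    (fun s hs => hP _ (hmem β hβ (hneb β right_mem_uIcc) s hs))
    (by simp only [zero_add]; exact hI0) (by simp only [zero_add]; exact hIβ) hb ?_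
  · simp only [zero_add] at key
    exact congrArg (y 0 z + ·) (add_left_cancel key)
  · filter_upwards [eventually_gt_atTop 0] with s hs w hw
    obtain ⟨a, b, ha, hb, hab, rfl⟩ := hw
    have e1 : a • (0 + (s : ℂ) * Complex.exp ((0 : ℝ) * Complex.I)) +
        b • (0 + (s : ℂ) * Complex.exp (β * Complex.I)) =
        rayPoint 0 (a * s) + rayPoint β (b * s) := by
      simp only [Complex.real_smul, rayPoint]
      push_cast
      ring
    rw [e1]
    have hsum : a * s + b * s = s := by rw [← add_mul, hab, one_mul]
    obtain ⟨γ, hγ, h2, -⟩ := exists_polar_of_combination (h0δ.trans_le hδ) (hβ.trans_le hδ)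
      (mul_nonneg ha hs.le) (mul_nonneg hb hs.le) (by rwa [hsum])
    have hre : s * Real.cos β ≤ (rayPoint 0 (a * s) + rayPoint β (b * s)).re := by
      rw [Complex.add_re, re_rayPoint, re_rayPoint, Real.cos_zero, mul_one]
      have h3 : a * s * Real.cos β ≤ a * s :=
        mul_le_of_le_one_right (mul_nonneg ha hs.le) (Real.cos_le_one β)
      calc s * Real.cos β = a * s * Real.cos β + b * s * Real.cos β := by rw [← add_mul, hsum]
        _ ≤ _ := by linarith
    have hnorm : ‖rayPoint 0 (a * s) + rayPoint β (b * s)‖ ≤ s := by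
      refine (norm_add_le _ _).trans (le_of_eq ?_)
      rw [norm_rayPoint _ (mul_nonneg ha hs.le), norm_rayPoint _ (mul_nonneg hb hs.le), hsum]
    have hpos : 0 < ‖rayPoint 0 (a * s) + rayPoint β (b * s)‖ :=
      (mul_pos hs hcos).trans_le (hre.trans (Complex.re_le_norm _))
    generalize rayPoint 0 (a * s) + rayPoint β (b * s) = w at *
    have hwmem : w ∈ borelDomain δ (χ z) := by
      rw [h2]
      exact rayPoint_mem_borelDomain hδ (abs_lt_of_mem_uIcc h0δ hβ hγ) (hneb γ hγ) hpos
    refine ⟨hP _ hwmem, ?_⟩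
    have hyw : ‖yB w z‖ ≤ C * Real.exp (B * s) := by
      have := hg γ hγ _ hpos
      rw [← h2] at this
      refine this.trans ?_
      gcongr
    rw [norm_mul, norm_exp_neg_div]
    calc Real.exp (-w.re / ε) * ‖yB w z‖
        ≤ Real.exp (-(s * Real.cos β) / ε) * (C * Real.exp (B * s)) := by gcongr
      _ = C * Real.exp (-(Real.cos β / ε - B) * s) := by
          rw [mul_left_comm, ← Real.exp_add]
          congr 2
          ring
      _ ≤ C * Real.exp (-s) := by
          gcongr
          nlinarith

/-- The late-term asymptotics in terms of the Taylor coefficients of the Borel transform. -/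
theorem IsParametricBorelTransform.hasLateCoefficients
    (hyB : IsParametricBorelTransform D δ χ y yB) {z : ℂ} (hz : z ∈ D) (hχ : χ z ≠ 0) {α A : ℂ}
    (hA : A ≠ 0) (hα : ∀ k : ℕ, α ≠ -(k : ℂ))
    (hlate : (fun n : ℕ => y (n + 1) z) ~[atTop]
      (fun n : ℕ => (n : ℂ) ^ (α - 1) * (n.factorial : ℂ) * (-1 : ℂ) ^ α * A /
        (χ z ^ ((n : ℂ) + α) * Complex.Gamma α))) :
    HasLateCoefficients (fun w => yB w z) (χ z) α ((-1 : ℂ) ^ α * A / χ z ^ α) := by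
  have hΓ : Complex.Gamma α ≠ 0 := Complex.Gamma_ne_zero hα
  have hm : (-1 : ℂ) ^ α ≠ 0 := by rw [Complex.cpow_ne_zero_iff]; exact Or.inl (by simp)
  have hχα : χ z ^ α ≠ 0 := by rw [Complex.cpow_ne_zero_iff]; exact Or.inl hχ
  have hcoeff : ∀ n : ℕ, iteratedDeriv n (fun w => yB w z) 0 / (n.factorial : ℂ) =
      y (n + 1) z / (n.factorial : ℂ) := by
    have h1 : HasFPowerSeriesAt (fun w => yB w z) (FormalMultilinearSeries.ofScalars ℂ
        fun n => y (n + 1) z / (n.factorial : ℂ)) 0 := by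
      rw [hasFPowerSeriesAt_iff]
      filter_upwards [hyB.germ z hz] with w hw
      rw [zero_add]
      have e : (fun n : ℕ => w ^ n • (FormalMultilinearSeries.ofScalars ℂ
          fun n => y (n + 1) z / (n.factorial : ℂ)).coeff n) =
          fun n : ℕ => y (n + 1) z / (n.factorial : ℂ) * w ^ n := by
        ext n
        rw [FormalMultilinearSeries.coeff_ofScalars, smul_eq_mul, mul_comm]
      rw [e]
      exact hw
    have h2 := h1.analyticAt.hasFPowerSeriesAt
    have h3 := h1.eq_formalMultilinearSeries h2
    intro n
    have h4 := congrArg (fun p => FormalMultilinearSeries.coeff p n) h3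
    simp only [FormalMultilinearSeries.coeff_ofScalars] at h4
    exact h4.symm
  have hne : ∀ᶠ n : ℕ in atTop, (n : ℂ) ^ (α - 1) * (n.factorial : ℂ) * (-1 : ℂ) ^ α * A /
        (χ z ^ ((n : ℂ) + α) * Complex.Gamma α) ≠ 0 := by
    filter_upwards [eventually_gt_atTop 0] with n hn
    have hn' : (n : ℂ) ≠ 0 := Nat.cast_ne_zero.2 hn.ne'
    have h1 : (n : ℂ) ^ (α - 1) ≠ 0 := by rw [Complex.cpow_ne_zero_iff]; exact Or.inl hn'
    have h2 : χ z ^ ((n : ℂ) + α) ≠ 0 := by rw [Complex.cpow_ne_zero_iff]; exact Or.inl hχ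
    have h3 : (n.factorial : ℂ) ≠ 0 := Nat.cast_ne_zero.2 n.factorial_ne_zero
    positivity
  have h1 := ((isEquivalent_iff_tendsto_one hne).1 hlate).mul_const
    ((-1 : ℂ) ^ α * A / χ z ^ α / Complex.Gamma α)
  rw [one_mul] at h1
  refine h1.congr' ?_
  filter_upwards [eventually_gt_atTop 0] with n hn
  have hn' : (n : ℂ) ≠ 0 := Nat.cast_ne_zero.2 hn.ne'
  have h1 : (n : ℂ) ^ (α - 1) ≠ 0 := by rw [Complex.cpow_ne_zero_iff]; exact Or.inl hn'
  have h3 : (n.factorial : ℂ) ≠ 0 := Nat.cast_ne_zero.2 n.factorial_ne_zero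
  simp only [Pi.div_apply]
  rw [hcoeff, Complex.cpow_add _ _ hχ, Complex.cpow_natCast]
  field_simp

end Parameter

/-! ### The Stokes phenomenon -/

theorem corollary3p1
    (D : Set ℂ) (hD : IsOpen D) (δ : ℝ) (hδ : 0 < δ) (hδ' : δ ≤ Real.pi / 2)
    (α : ℂ) (hα : ∀ k : ℕ, α ≠ -(k : ℂ))
    (y : ℕ → ℂ → ℂ) (hy : ∀ n, DifferentiableOn ℂ (y n) D)
    (χ : ℂ → ℂ) (hχ : DifferentiableOn ℂ χ D) (hχδ : ∀ z ∈ D, χ z ∈ openSector δ)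
    (a : ℂ → ℂ) (ha : ∀ z ∈ D, a z ≠ 0)
    -- late-term asymptotics
    (hlate : ∀ z ∈ D, (fun n : ℕ => y (n + 1) z) ~[atTop]
      (fun n : ℕ => (n : ℂ) ^ (α - 1) * (n.factorial : ℂ) * (-1 : ℂ) ^ α * a z /
        (χ z ^ ((n : ℂ) + α) * Complex.Gamma α)))
    -- the Borel transform, its singularity at `χ(z)`, and Borel summability off the direction of it
    (yB : ℂ → ℂ → ℂ) (hyB : IsParametricBorelTransform D δ χ y yB)
    (hsing : ∀ z ∈ D, HasPowerLawSingularity (fun w => yB w z) (χ z) α)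
    (hsum : ∀ z ∈ D, ∀ θ : ℝ, |θ| < δ → θ ≠ Complex.arg (χ z) → BorelSummableAt yB θ z)
    (θ : ℝ) (hθ : 0 < θ) (hθδ : θ < δ) :
    -- `V` is an open neighbourhood of the Stokes line
    let V : Set ℂ := {z ∈ D | |Complex.arg (χ z)| < θ}
    IsOpen V ∧ stokesLine D χ ⊆ V ∧
    -- the sums along the rays above and below `χ(z)` are defined and holomorphic throughout `V`
    (∀ z₁ ∈ V, ∀ᶠ p : ℝ × ℂ in 𝓝[>] (0 : ℝ) ×ˢ 𝓝 z₁,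
      BorelSumExists yB θ p.1 p.2 ∧ DifferentiableAt ℂ (borelSum y yB θ p.1) p.2 ∧
      BorelSumExists yB (-θ) p.1 p.2 ∧ DifferentiableAt ℂ (borelSum y yB (-θ) p.1) p.2) ∧
    -- on the two sides of the Stokes line they are the Borel sum along `(0, ∞)`
    (∀ z₁ ∈ V, (χ z₁).im < 0 → ∀ᶠ p : ℝ × ℂ in 𝓝[>] (0 : ℝ) ×ˢ 𝓝 z₁,
      BorelSumExists yB 0 p.1 p.2 ∧ borelSum y yB 0 p.1 p.2 = borelSum y yB θ p.1 p.2) ∧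
    (∀ z₁ ∈ V, 0 < (χ z₁).im → ∀ᶠ p : ℝ × ℂ in 𝓝[>] (0 : ℝ) ×ˢ 𝓝 z₁,
      BorelSumExists yB 0 p.1 p.2 ∧ borelSum y yB 0 p.1 p.2 = borelSum y yB (-θ) p.1 p.2) ∧
    -- their difference
    (∀ z ∈ V, (fun ε : ℝ => borelSum y yB θ ε z - borelSum y yB (-θ) ε z) ~[𝓝[>] (0 : ℝ)]
      (fun ε : ℝ => 2 * Real.pi * Complex.I * (-1 : ℂ) ^ α * a z /
        ((ε : ℂ) ^ (α - 1) * Complex.Gamma α) * Complex.exp (-(χ z) / (ε : ℂ)))) := by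
  intro V
  have hmem : ∀ z ∈ V, z ∈ D := fun z hz => hz.1
  have hθ1 : |θ| < δ := by rwa [abs_of_pos hθ]
  have hθ2 : |-θ| < δ := by rwa [abs_neg]
  have hne1 : ∀ z ∈ V, θ ≠ (χ z).arg := fun z hz h => by
    have := hz.2
    rw [← h, abs_of_pos hθ] at this
    exact this.false
  have hne2 : ∀ z ∈ V, -θ ≠ (χ z).arg := fun z hz h => by
    have := hz.2
    rw [← h, abs_neg, abs_of_pos hθ] at this
    exact this.false
  refine ⟨?_, ?_, ?_, ?_, ?_, ?_⟩
  · rw [isOpen_iff_mem_nhds]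
    rintro z ⟨hzD, hz⟩
    filter_upwards [hD.eventually_mem hzD,
      (continuousAt_arg_singularity hD hδ' hχ hχδ hzD).abs.eventually_lt_const hz] with x h1 h2
    exact ⟨h1, h2⟩
  · rintro z ⟨hzD, him, hre⟩
    refine ⟨hzD, ?_⟩
    rwa [Complex.arg_eq_zero_iff.2 ⟨hre.le, him⟩, abs_zero]
  · intro z₁ hz₁
    have h1 := eventually_borelSum_differentiableAt hD hδ' (hy 0) hχ hχδ hyB (hmem _ hz₁) hθ1
      (hne1 _ hz₁) (hsum z₁ (hmem _ hz₁) θ hθ1 (hne1 _ hz₁))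
    have h2 := eventually_borelSum_differentiableAt hD hδ' (hy 0) hχ hχδ hyB (hmem _ hz₁) hθ2
      (hne2 _ hz₁) (hsum z₁ (hmem _ hz₁) (-θ) hθ2 (hne2 _ hz₁))
    filter_upwards [h1, h2] with p h3 h4 using ⟨h3.1, h3.2, h4.1, h4.2⟩
  · intro z₁ hz₁ him
    have hK : (χ z₁).arg ∉ uIcc 0 θ := by
      rw [uIcc_of_le hθ.le]
      exact fun h => absurd (Complex.arg_nonneg_iff.1 h.1) (not_le.2 him)
    refine eventually_borelSum_eq hD hδ hδ' hχ hχδ hyB (hmem _ hz₁) hθ1 hK fun b hb => ?_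
    exact hsum z₁ (hmem _ hz₁) b (abs_lt_of_mem_uIcc (by simpa using hδ) hθ1 hb)
      fun h => hK (h ▸ hb)
  · intro z₁ hz₁ him
    have hK : (χ z₁).arg ∉ uIcc 0 (-θ) := by
      rw [uIcc_of_ge (by linarith)]
      intro h
      have h0 := Complex.arg_nonneg_iff.2 him.le
      have h1 := (Complex.arg_eq_zero_iff.1 (le_antisymm h.2 h0)).2
      exact him.ne' h1
    refine eventually_borelSum_eq hD hδ hδ' hχ hχδ hyB (hmem _ hz₁) hθ2 hK fun b hb => ?_
    exact hsum z₁ (hmem _ hz₁) b (abs_lt_of_mem_uIcc (by simpa using hδ) hθ2 hb)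
      fun h => hK (h ▸ hb)
  · intro z hz
    have hzD := hmem z hz
    have hχz := hχδ z hzD
    obtain ⟨h, g, hh, hg, -, hfg⟩ := hsing z hzD
    have hgrow : SectorialGrowth (fun w => yB w z) δ (χ z).arg := by
      intro K hK hKs
      obtain ⟨C, B, hC, hB, h1⟩ := exists_uniform_growth hK
        fun β hβ => hsum z hzD β (hKs β hβ).1 (hKs β hβ).2
      exact ⟨C, B, hC, hB, h1.self_of_nhds⟩
    -- `m` derivatives bring the order of the singularity above `1`
    obtain ⟨m, hm⟩ := exists_nat_gt (1 - α.re)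
    have hlim := tendsto_jump_of_lateCoefficients hδ' hχz hθδ hz.2 m (fun w => yB w z) h g α _
      (by linarith) hα (hyB.differentiableOn_left hzD) hgrow ⟨hh, hg, hfg⟩
      (hyB.hasLateCoefficients hzD hχz.1 (ha z hzD) hα (hlate z hzD))
    have hΓ : Complex.Gamma α ≠ 0 := Complex.Gamma_ne_zero hα
    have hpow : ∀ w : ℂ, w ≠ 0 → ∀ β : ℂ, w ^ β ≠ 0 := fun w hw β => by
      rw [Complex.cpow_ne_zero_iff]; exact Or.inl hw
    have hm1 := hpow (-1) (by simp) α
    have hχα := hpow (χ z) hχz.1 α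
    have haz := ha z hzD
    have hpi : (Real.pi : ℂ) ≠ 0 := Complex.ofReal_ne_zero.2 Real.pi_ne_zero
    set L : ℂ := 2 * Real.pi * Complex.I * (-1 : ℂ) ^ α * a z / Complex.Gamma α with hL
    have hnum : 2 * Real.pi * Complex.I * (-1 : ℂ) ^ α * a z ≠ 0 :=
      mul_ne_zero (mul_ne_zero Complex.two_pi_I_ne_zero hm1) haz
    have hL0 : L ≠ 0 := div_ne_zero hnum hΓ
    have e1 : 2 * Real.pi * Complex.I * ((-1 : ℂ) ^ α * a z / χ z ^ α) * χ z ^ α /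
        Complex.Gamma α = L := by
      rw [hL]; field_simp
    rw [e1] at hlim
    rw [isEquivalent_iff_tendsto_one]
    · have h2 := hlim.div_const L
      rw [div_self hL0] at h2
      refine h2.congr' ?_
      filter_upwards [self_mem_nhdsWithin] with ε hε
      have hε1 := hpow (ε : ℂ) (Complex.ofReal_ne_zero.2 (ne_of_gt hε)) (α - 1)
      have e2 : borelSum y yB θ ε z - borelSum y yB (-θ) ε z =
          laplaceRay (fun w => yB w z) θ ε - laplaceRay (fun w => yB w z) (-θ) ε :=
        add_sub_add_left_eq_sub _ _ _
      simp only [Pi.div_apply]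
      rw [e2, hL, neg_div, Complex.exp_neg]
      have := Complex.exp_ne_zero (χ z / ε)
      have := Complex.I_ne_zero
      field_simp
    · filter_upwards [self_mem_nhdsWithin] with ε hε
      have hε1 := hpow (ε : ℂ) (Complex.ofReal_ne_zero.2 (ne_of_gt hε)) (α - 1)
      exact mul_ne_zero (div_ne_zero hnum (mul_ne_zero hε1 hΓ)) (Complex.exp_ne_zero _)
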